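/- **Setting.** Let $\mathscr P=\{\mathscr P_{n,\pm}\}_{n\ge 0}$ be a $C^*$-planar algebra: a (shaded, unital) planar $*$-algebra over $\mathbb C$ in which every box space $\mathscr P_{n,\pm}$ is a finite-dimensional $C^*$-algebra (in the product $xy$ the box $y$ is stacked on top of $x$), together with linear functionals $tr_{0,\pm}$ on $\mathscr P_{0,\pm}$ such that composing $tr_{0,\pm}$ with the closure of all strings on the right gives a faithful positive trace $tr_{n,\pm}$ on each $\mathscr P_{n,\pm}$. For a $1$-box $y$ let $\overline y$ be its rotation by $180^\circ$; for a $2$-box $x\in\mathscr P_{2,\pm}$ let $\widehat x\in\mathscr P_{2,\mp}$ be its Fourier transform, i.e. its clockwise rotation by $90^\circ$. For 1-boxes $y\in\mathscr P_{1,\pm}$, $z\in\mathscr P_{1,\mp}$ and a 2-box $w\in\mathscr P_{2,\mp}$, $y*w\in\mathscr P_{1,\pm}$ is obtained by joining the string of $y$, placed to the left of $w$, with the left string of $w$ at top and bottom, and $w*z\in\mathscr P_{1,\mp}$ by joining the string of $z$, placed to the right of $w$, with the right string of $w$ at top and bottom. Horizontal juxtaposition is written $\otimes$. An element $a$ of a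 $C^*$-algebra is positive if $a=bb^*$ for some $b$; $\mathcal R(a)$ is its range projection, the least projection $q$ with $qa=a$; and $q^\perp=I-q$. Let $x\in\mathscr P_{2,\pm}$ be $\mathfrak F$-positive, i.e. $\widehat x\ge 0$, and let $r$ be the spectral radius of $x$ in the algebra $\mathscr P_{2,\pm}$. Put $$\mathcal E=\{y\in\mathscr P_{1,\pm}: y*\widehat x=ry\},\quad \mathcal E^+=\{y\in\mathcal E: y\ge 0\},\quad \mathscr Q=\{\mathcal R(y): y\in\mathcal E^+\}.$$ A right PF eigenvector of $x$ is a nonzero positive $y_1\in\mathscr P_{1,\mp}$ with $\widehat x*y_1=ry_1$. **Theorem.** The set $\mathscr Q$ has a largest projection $p=p_{\max}$. With $x_p=(p\otimes\overline p)\,x\,(p\otimes\overline p)$, the series $\sum_{j\ge0}x_p^j/z^{j+1}$ converges for every real $z>r$, and the limit $$y_p=\lim_{z\to r^+}(z-r)\sum_{j=0}^\infty\frac{x_p^j}{z^{j+1}}$$ exists. Let $\zeta=p*\widehat{y_p}\in\mathscr P_{1,\pm}$ (the PF eigenvector of maximal support), let $\zeta^{-1/2}$ be the inverse of $\zeta^{1/2}$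 on the range of $\zeta$, extended by $0$ on the orthogonal complement, and put $$x_\zeta=(\zeta^{1/2}\otimes\overline{\zeta^{1/2}})\,x\,(\zeta^{-1/2}\otimes\overline{\zeta^{-1/2}}),$$ $$\mathcal C_\zeta=\{y\in\mathscr P_{1,\pm}:\ x_\zeta(I\otimes\overline y)=(I\otimes\overline y)x_\zeta,\ \ x_\zeta(y\otimes I)=(y\otimes I)x_\zeta\},\quad \mathcal C_\zeta^+=\{y\in\mathcal C_\zeta:y\ge0\}.$$ If there is a right PF eigenvector $y_1\in\mathscr P_{1,\mp}$ of $x$ with $p_{\max}\wedge\overline{\mathcal R(y_1)}^{\perp}=0$, then $$\mathcal E^+=\zeta^{1/2}\,\mathcal C_\zeta^+\,\zeta^{1/2}.$$ -/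

import Mathlib

open Filter Topology

universe u

noncomputable section

/-! ## Planar algebras

Regions of a planar diagram are coloured by `Bool` (`true` for the unshaded colour `+`, `false` for
the shaded colour `-`), and the two sides of a string have opposite colours.

A planar algebra is presented by its diagrams in rectangular form.  `Hom s m n` is the space of
boxes whose leftmost region has colour `s`, with `m` strings leaving at the top and `n` strings
leaving at the bottom; the marked interval is on the left.  The `n`-box space `P_{n,s}` is
`Hom s n n`, and `Hom s m n` for `m + n = 2 k` is the space `P_{k,s}` with its `2 k` boundary points
distributed differently.  Every planar tangle is, up to isotopy, cut by horizontal lines into layers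
that consist of vertical strings and one input disc, one maximum or one minimum; so the action of
planar tangles is generated by vertical composition, horizontal juxtaposition, the identity strings,
the cup and the cap, and planar isotopy is generated by the interchange law, the straightening
of zigzags and the invariance of a disc under the rotation by `2 π`. -/

/-- The colour of the region reached from a region of colour `s` by crossing `m` strings. -/
def shade (s : Bool) : ℕ → Bool
  | 0 => s
  | m + 1 => !(shade s m)

theorem shade_zero (s : Bool) : shade s 0 = s := rfl

theorem shade_one (s : Bool) : shade s 1 = !s := rfl

theorem shade_two (s : Bool) : shade s 2 = s := Bool.not_not s

theorem shade_not_one (s : Bool) : shade (!s) 1 = s := Bool.not_not s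

theorem shade_not (s : Bool) (m : ℕ) : shade (!s) m = !(shade s m) := by
  induction m with
  | zero => rfl
  | succ m ih => simp only [shade, ih]

theorem shade_shade (s : Bool) (k m : ℕ) : shade (shade s k) m = shade (shade s m) k := by
  induction k with
  | zero => rfl
  | succ k ih => simp only [shade, shade_not, ih]

/-- Rectangular diagrams, up to the rotation by `2 π`. -/
structure PlanarCalculus where
  /-- `Hom s m n`: boxes with leftmost region `s`, `m` strings at the top, `n` at the bottom. -/
  Hom : Bool → ℕ → ℕ → Type u
  [addCommGroup : ∀ s m n, AddCommGroup (Hom s m n)]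
  [module : ∀ s m n, Module ℂ (Hom s m n)]
  /-- `m` vertical strings. -/
  one : ∀ s m, Hom s m m
  /-- Vertical composition; `comp f g` has `g` on top of `f`. -/
  comp : ∀ {s l m n}, Hom s m n →ₗ[ℂ] Hom s l m →ₗ[ℂ] Hom s l n
  /-- Horizontal juxtaposition, possible when the region right of the first box is the region left
  of the second one. -/
  tens : ∀ {s t m n m' n'}, shade s m = t → shade s n = t →
    (Hom s m n →ₗ[ℂ] Hom t m' n' →ₗ[ℂ] Hom s (m + m') (n + n'))
  /-- The string `∪` that joins two points at the top. -/
  cup : ∀ s, Hom s 2 0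
  /-- The string `∩` that joins two points at the bottom. -/
  cap : ∀ s, Hom s 0 2
  /-- A disc has an even number of boundary points. -/
  odd : ∀ {s m n}, shade s m ≠ shade s n → Subsingleton (Hom s m n)
  one_comp : ∀ {s m n} (f : Hom s m n), comp (one s n) f = f
  comp_one : ∀ {s m n} (f : Hom s m n), comp f (one s m) = f
  comp_assoc : ∀ {s k l m n} (f : Hom s m n) (g : Hom s l m) (h : Hom s k l),
    comp (comp f g) h = comp f (comp g h)
  one_tens_one : ∀ {s t m m'} (h : shade s m = t),
    tens h h (one s m) (one t m') = one s (m + m')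
  tens_comp : ∀ {s t l m n l' m' n'} (hl : shade s l = t) (hm : shade s m = t)
    (hn : shade s n = t) (f : Hom s m n) (f' : Hom s l m) (g : Hom t m' n') (g' : Hom t l' m'),
    tens hl hn (comp f f') (comp g g') = comp (tens hm hn f g) (tens hl hm f' g')
  tens_one : ∀ {s t m n} (hm : shade s m = t) (hn : shade s n = t) (f : Hom s m n),
    tens hm hn f (one t 0) = f
  one_tens : ∀ {s m n} (f : Hom s m n),
    HEq (tens (s := s) (m := 0) (n := 0) (shade_zero s) (shade_zero s) (one s 0) f) f
  tens_assoc : ∀ {s t v m n m' n' m'' n''} (hm : shade s m = t) (hn : shade s n = t)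
    (hm' : shade t m' = v) (hn' : shade t n' = v) (km : shade s (m + m') = v)
    (kn : shade s (n + n') = v) (f : Hom s m n) (g : Hom t m' n') (h : Hom v m'' n''),
    HEq (tens km kn (tens hm hn f g) h) (tens hm hn f (tens hm' hn' g h))
  zigzag_left : ∀ s, comp
    (tens (shade_two s) (shade_zero s) (cup s) (one s 1) : Hom s 3 1)
    (tens (shade_one s) (shade_one s) (one s 1) (cap (!s)) : Hom s 1 3) = one s 1
  zigzag_right : ∀ s, comp
    (tens (shade_one s) (shade_one s) (one s 1) (cup (!s)) : Hom s 3 1)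
    (tens (shade_zero s) (shade_two s) (cap s) (one s 1) : Hom s 1 3) = one s 1

namespace PlanarCalculus

attribute [instance] PlanarCalculus.addCommGroup PlanarCalculus.module

variable (P : PlanarCalculus.{u})

/-- The identification of two spaces of boxes with equal numbers of strings. -/
def recast {s : Bool} {m n m' n' : ℕ} (hm : m = m') (hn : n = n') (f : P.Hom s m n) :
    P.Hom s m' n' := hm ▸ hn ▸ f

/-- The first of the `n + 1` bottom strings is bent up on the left of the box. -/
def bendUp {s : Bool} {n : ℕ} (f : P.Hom s 0 (n + 1)) : P.Hom (!s) 1 n :=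
  P.comp
    (P.recast (m' := 1 + (n + 1)) (n' := n) (by omega) (by omega)
      (P.tens (shade_two (!s)) (shade_zero (!s)) (P.cup (!s)) (P.one (!s) n)))
    (P.tens (shade_not_one s) (shade_not_one s) (P.one (!s) 1) f)

/-- The top string is bent down on the right of the box. -/
def bendDown {s : Bool} {n : ℕ} (h : shade s n = !s) (f : P.Hom s 1 n) : P.Hom s 0 (n + 1) :=
  P.comp (P.tens (shade_one s) h f (P.one (!s) 1)) (P.cap s)

/-- The one-click rotation of a box whose `n + 1` strings all leave at the bottom: the first string
is bent around the top of the box and becomes the last one. -/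
def click {s : Bool} {n : ℕ} (h : shade s (n + 1) = s) (f : P.Hom s 0 (n + 1)) :
    P.Hom (!s) 0 (n + 1) :=
  P.bendDown (by rw [shade_not, ← shade, h, Bool.not_not]) (P.bendUp f)

/-- The `k`-fold iteration of the one-click rotation. -/
def clicks {s : Bool} {n : ℕ} (h : shade s (n + 1) = s) (f : P.Hom s 0 (n + 1)) :
    (k : ℕ) → P.Hom (shade s k) 0 (n + 1)
  | 0 => f
  | k + 1 => P.click (by rw [shade_shade, h]) (clicks h f k)

/-- The last string of an `(n + 1)`-box is closed up on the right. -/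
def closeLast {s : Bool} {n : ℕ} (f : P.Hom s (n + 1) (n + 1)) : P.Hom s n n :=
  P.comp (P.tens (t := shade s n) rfl rfl (P.one s n) (P.cup (shade s n)))
    (P.comp (P.tens (t := shade s (n + 1)) rfl rfl f (P.one (shade s (n + 1)) 1))
      (P.tens (t := shade s n) rfl rfl (P.one s n) (P.cap (shade s n))))

/-- All strings of a box are closed up on the right. -/
def closure {s : Bool} : {n : ℕ} → P.Hom s n n → P.Hom s 0 0
  | 0, f => f
  | _ + 1, f => closure (P.closeLast f)

end PlanarCalculus

/-- A (shaded, unital) planar algebra. -/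
structure PlanarAlgebra extends PlanarCalculus.{u} where
  /-- The rotation of a disc by `2 π` is trivial. -/
  full_rotation : ∀ {s n} (h : shade s (n + 1) = s) (f : Hom s 0 (n + 1)),
    HEq (toPlanarCalculus.clicks h f (n + 1)) f

/-- A C⋆-planar algebra: a planar ⋆-algebra whose box spaces `P_{n,s} = Hom s n n` are finite
dimensional C⋆-algebras, with a linear functional on each `P_{0,s}` whose composition with the
closure on the right is a faithful positive trace `tr_{n,s}` on each `P_{n,s}`. -/
structure CStarPlanarAlgebra extends PlanarAlgebra.{u} where
  /-- The involution reflects a diagram in a horizontal line. -/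
  adj : ∀ {s m n}, Hom s m n →ₗ⋆[ℂ] Hom s n m
  adj_adj : ∀ {s m n} (f : Hom s m n), adj (adj f) = f
  adj_comp : ∀ {s l m n} (f : Hom s m n) (g : Hom s l m),
    adj (comp f g) = comp (adj g) (adj f)
  adj_tens : ∀ {s t m n m' n'} (hm : shade s m = t) (hn : shade s n = t) (f : Hom s m n)
    (g : Hom t m' n'), adj (tens hm hn f g) = tens hn hm (adj f) (adj g)
  adj_cup : ∀ s, adj (cup s) = cap s
  finiteDimensional : ∀ s n, FiniteDimensional ℂ (Hom s n n)
  /-- The C⋆-norm. -/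
  cnorm : ∀ s n, AddGroupNorm (Hom s n n)
  cnorm_smul : ∀ {s n} (c : ℂ) (f : Hom s n n), cnorm s n (c • f) = ‖c‖ * cnorm s n f
  cnorm_comp_le : ∀ {s n} (f g : Hom s n n), cnorm s n (comp f g) ≤ cnorm s n f * cnorm s n g
  cnorm_adj_comp : ∀ {s n} (f : Hom s n n), cnorm s n (comp (adj f) f) = cnorm s n f ^ 2
  /-- The traces on the `0`-box spaces. -/
  tr₀ : ∀ s, Hom s 0 0 →ₗ[ℂ] ℂ
  tr_pos : ∀ {s n} (f : Hom s n n), f ≠ 0 →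
    0 < (tr₀ s (toPlanarCalculus.closure (comp (adj f) f))).re ∧
      (tr₀ s (toPlanarCalculus.closure (comp (adj f) f))).im = 0

namespace CStarPlanarAlgebra

variable (P : CStarPlanarAlgebra.{u})

/-- The `n`-box space `P_{n,s}`. -/
def Box (s : Bool) (n : ℕ) : Type u := P.Hom s n n

instance instAddCommGroup (s : Bool) (n : ℕ) : AddCommGroup (P.Box s n) := P.addCommGroup s n n

/-- The product `x y` has `y` on top of `x`. -/
instance instMul (s : Bool) (n : ℕ) : Mul (P.Box s n) := ⟨fun f g => P.comp (s := s) f g⟩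

instance instOne (s : Bool) (n : ℕ) : One (P.Box s n) := ⟨P.one s n⟩

instance instStar (s : Bool) (n : ℕ) : Star (P.Box s n) := ⟨fun f => P.adj (s := s) f⟩

instance instRing (s : Bool) (n : ℕ) : Ring (P.Box s n) :=
  { instAddCommGroup P s n, instMul P s n, instOne P s n with
    left_distrib := fun f g h => map_add (P.comp (s := s) f) g h
    right_distrib := fun f g h => LinearMap.map_add₂ (P.comp (s := s)) f g h
    zero_mul := fun f => LinearMap.map_zero₂ (P.comp (s := s)) f
    mul_zero := fun f => map_zero (P.comp (s := s) f)
    mul_assoc := fun f g h => P.comp_assoc (s := s) f g h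
    one_mul := fun f => P.one_comp (s := s) f
    mul_one := fun f => P.comp_one (s := s) f }

instance instStarRing (s : Bool) (n : ℕ) : StarRing (P.Box s n) :=
  { instStar P s n with
    star_involutive := fun f => P.adj_adj (s := s) f
    star_mul := fun f g => P.adj_comp (s := s) f g
    star_add := fun f g => map_add (P.adj (s := s)) f g }

instance instAlgebra (s : Bool) (n : ℕ) : Algebra ℂ (P.Box s n) :=
  letI : Module ℂ (P.Box s n) := P.module s n n
  Algebra.ofModule (fun c f g => LinearMap.map_smul₂ (P.comp (s := s)) c f g)
    (fun c f g => map_smul (P.comp (s := s) f) c g)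

instance instStarModule (s : Bool) (n : ℕ) : StarModule ℂ (P.Box s n) :=
  ⟨fun c f => LinearMap.map_smulₛₗ (P.adj (s := s)) c f⟩

instance instNormedRing (s : Bool) (n : ℕ) : NormedRing (P.Box s n) :=
  { instRing P s n, (P.cnorm s n).toNormedAddCommGroup with
    norm_mul_le := fun f g => P.cnorm_comp_le (s := s) f g }

instance instNormedAlgebra (s : Bool) (n : ℕ) : NormedAlgebra ℂ (P.Box s n) :=
  { instAlgebra P s n with
    norm_smul_le := fun c f => (P.cnorm_smul (s := s) c f).le }

instance instFiniteDimensional (s : Bool) (n : ℕ) : FiniteDimensional ℂ (P.Box s n) :=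
  P.finiteDimensional s n

instance instCStarAlgebra (s : Bool) (n : ℕ) : CStarAlgebra (P.Box s n) :=
  { instNormedRing P s n, instStarRing P s n, instNormedAlgebra P s n, instStarModule P s n with
    toCompleteSpace := FiniteDimensional.complete ℂ (P.Box s n)
    norm_mul_self_le := fun f =>
      ((pow_two _).symm.trans (P.cnorm_adj_comp (s := s) f).symm).le }

/-- The horizontal juxtaposition `a ⊗ b` of two `1`-boxes. -/
def juxt {s : Bool} (a : P.Box s 1) (b : P.Box (!s) 1) : P.Box s 2 :=
  P.tens (s := s) (t := !s) (m := 1) (n := 1) (shade_one s) (shade_one s) a b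

/-- The rotation by `π` of a `1`-box. -/
def bar {s t : Bool} (h : shade t 1 = s) (y : P.Box s 1) : P.Box t 1 :=
  P.comp (s := t) (m := 3) (l := 1)
    (P.tens (s := t) (shade_two t) (shade_zero t) (P.cup t) (P.one t 1))
    (P.comp (s := t) (m := 3) (l := 1)
      (P.tens (s := t) (t := t) (m := 2) (n := 2) (shade_two t) (shade_two t)
        (P.tens (s := t) (t := s) h h (P.one t 1) y) (P.one t 1))
      (P.tens (s := t) (t := s) h h (P.one t 1) (P.cap s)))

/-- The Fourier transform `x̂` of a `2`-box: its clockwise rotation by `π / 2`. -/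
def fourier {s : Bool} (x : P.Box s 2) : P.Box (!s) 2 :=
  P.comp (s := !s) (m := 4) (l := 2)
    (P.tens (s := !s) (shade_two (!s)) (shade_zero (!s)) (P.cup (!s)) (P.one (!s) 2))
    (P.comp (s := !s) (m := 4) (l := 2)
      (P.tens (s := !s) (t := s) (m := 3) (n := 3)
        ((shade_two (shade (!s) 1)).trans (shade_not_one s))
        ((shade_two (shade (!s) 1)).trans (shade_not_one s))
        (P.tens (s := !s) (t := s) (m := 1) (n := 1) (m' := 2) (n' := 2)
          (shade_not_one s) (shade_not_one s) (P.one (!s) 1) x)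
        (P.one s 1))
      (P.tens (s := !s) (shade_two (!s)) (shade_two (!s)) (P.one (!s) 2) (P.cap (!s))))

/-- The convolution `y * w` of a `1`-box with a `2`-box on its right: the string of `y` is joined at
the top and at the bottom to the left string of `w`. -/
def convL {s : Bool} (y : P.Box s 1) (w : P.Box (!s) 2) : P.Box s 1 :=
  P.comp (s := s) (m := 3) (l := 1)
    (P.tens (s := s) (shade_two s) (shade_zero s) (P.cup s) (P.one s 1))
    (P.comp (s := s) (m := 3) (l := 1)
      (P.tens (s := s) (t := !s) (m := 1) (n := 1) (m' := 2) (n' := 2) (shade_one s) (shade_one s) y w)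
      (P.tens (s := s) (shade_zero s) (shade_two s) (P.cap s) (P.one s 1)))

/-- The convolution `w * z` of a `2`-box with a `1`-box on its right: the string of `z` is joined at
the top and at the bottom to the right string of `w`. -/
def convR {s : Bool} (w : P.Box (!s) 2) (z : P.Box (!s) 1) : P.Box (!s) 1 :=
  P.comp (s := !s) (m := 3) (l := 1)
    (P.tens (s := !s) (t := s) (shade_not_one s) (shade_not_one s) (P.one (!s) 1) (P.cup s))
    (P.comp (s := !s) (m := 3) (l := 1)
      (P.tens (s := !s) (t := !s) (m := 2) (n := 2) (m' := 1) (n' := 1)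
        (shade_two (!s)) (shade_two (!s)) w z)
      (P.tens (s := !s) (t := s) (shade_not_one s) (shade_not_one s) (P.one (!s) 1) (P.cap s)))

variable {P}

/-! ## Perron–Frobenius eigenvectors -/

/-- A positive element `a = b b⋆` of a C⋆-algebra. -/
def Pos {A : Type*} [Mul A] [Star A] (a : A) : Prop := ∃ b : A, a = b * star b

/-- `q` is the range projection of `a`: the least projection with `q a = a`. -/
def IsRangeProj {A : Type*} [Mul A] [Star A] (a q : A) : Prop :=
  IsStarProjection q ∧ q * a = a ∧ ∀ q' : A, IsStarProjection q' → q' * a = a → q' * q = q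

/-- The infimum of the projections `p` and `q` is `0`: no nonzero projection lies below both. -/
def MeetZero {A : Type*} [Mul A] [Star A] [Zero A] (p q : A) : Prop :=
  ∀ e : A, IsStarProjection e → p * e = e → q * e = e → e = 0

/-- `x` is `𝔉`-positive. -/
def FPositive {s : Bool} (x : P.Box s 2) : Prop := Pos (P.fourier x)

/-- The spectral radius of `x`, as a real number. -/
def specRad {s : Bool} (x : P.Box s 2) : ℝ := (spectralRadius ℂ x).toReal

/-- The Perron–Frobenius eigenspace `ℰ = {y : y * x̂ = r y}`. -/
def PFSpace {s : Bool} (x : P.Box s 2) : Set (P.Box s 1) :=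
  {y | P.convL y (P.fourier x) = (specRad x : ℂ) • y}

/-- The set `ℰ⁺` of positive elements of the eigenspace. -/
def PFCone {s : Bool} (x : P.Box s 2) : Set (P.Box s 1) := {y | y ∈ PFSpace x ∧ Pos y}

/-- A right Perron–Frobenius eigenvector: a nonzero positive `z` with `x̂ * z = r z`. -/
def IsRightPF {s : Bool} (x : P.Box s 2) (z : P.Box (!s) 1) : Prop :=
  P.convR (P.fourier x) z = (specRad x : ℂ) • z ∧ Pos z ∧ z ≠ 0

/-- The set `𝒬` of range projections of the elements of `ℰ⁺`. -/
def rangeProjs {s : Bool} (x : P.Box s 2) : Set (P.Box s 1) := {q | ∃ y ∈ PFCone x, IsRangeProj y q}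

/-- `p` is the largest projection in `𝒬`. -/
def IsPMax {s : Bool} (x : P.Box s 2) (p : P.Box s 1) : Prop :=
  p ∈ rangeProjs x ∧ ∀ q ∈ rangeProjs x, p * q = q

/-- The cut-down `x_p = (p ⊗ p̄) x (p ⊗ p̄)`. -/
def cutDown {s : Bool} (x : P.Box s 2) (p : P.Box s 1) : P.Box s 2 :=
  P.juxt p (P.bar (shade_not_one s) p) * x * P.juxt p (P.bar (shade_not_one s) p)

/-- `ζ` is the maximal-support eigenvector of `x`, where `p` is the largest projection in `𝒬`:
`ζ = p * ŷ_p` with `y_p = lim_{z → r⁺} (z - r) ∑_j x_p ^ j / z ^ (j + 1)`; the convergence of the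
series for `z > r` and the existence of the limit are part of the assertion. -/
def IsMaxSupportVector {s : Bool} (x : P.Box s 2) (p ζ : P.Box s 1) : Prop :=
  ∃ (S : ℝ → P.Box s 2) (y : P.Box s 2),
    (∀ z : ℝ, specRad x < z →
      HasSum (fun j : ℕ => ((z : ℂ) ^ (j + 1))⁻¹ • cutDown x p ^ j) (S z)) ∧
    Tendsto (fun z : ℝ => ((z - specRad x : ℝ) : ℂ) • S z) (𝓝[>] specRad x) (𝓝 y) ∧
    ζ = P.convL p (P.fourier y)

/-- The square root `ζ ^ (1 / 2)` of a positive element. -/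
def sqrtElt {s : Bool} (ζ : P.Box s 1) : P.Box s 1 := cfc (fun t : ℝ => √t) ζ

/-- The inverse `ζ ^ (-1 / 2)` of `ζ ^ (1 / 2)` on the range projection of `ζ`, zero on its
complement (`0⁻¹ = 0` in `ℝ`). -/
def invSqrtElt {s : Bool} (ζ : P.Box s 1) : P.Box s 1 := cfc (fun t : ℝ => (√t)⁻¹) ζ

/-- `x_ζ = (ζ ^ (1 / 2) ⊗ bar (ζ ^ (1 / 2))) x (ζ ^ (-1 / 2) ⊗ bar (ζ ^ (-1 / 2)))`. -/
def conjElt {s : Bool} (x : P.Box s 2) (ζ : P.Box s 1) : P.Box s 2 :=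
  P.juxt (sqrtElt ζ) (P.bar (shade_not_one s) (sqrtElt ζ)) * x *
    P.juxt (invSqrtElt ζ) (P.bar (shade_not_one s) (invSqrtElt ζ))

/-- The exchange algebra `𝒞` of `x`. -/
def exchange {s : Bool} (x : P.Box s 2) : Set (P.Box s 1) :=
  {y | x * P.juxt 1 (P.bar (shade_not_one s) y) = P.juxt 1 (P.bar (shade_not_one s) y) * x ∧
    x * P.juxt y 1 = P.juxt y 1 * x}

/-- The set `𝒞⁺` of positive elements of the exchange algebra. -/
def exchangePos {s : Bool} (x : P.Box s 2) : Set (P.Box s 1) := {y | y ∈ exchange x ∧ Pos y}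

end CStarPlanarAlgebra
end

noncomputable section

/-! A 2-box `x` acts on 1-boxes by `act x y = y * x̂`. Bending strings shows that this is the action
of `x` on the functionals `∪ ∘ (y ⊗ 1)`, so it reverses products, and `a ⊗ b̄` acts by `y ↦ b y a`.
If `x̂ ≥ 0` the action preserves positivity: the convolution of `a a⋆` with `b b⋆`, cut at
mid-height, is `V V⋆` for a rectangular `V`, and such boxes are positive because the traces are
faithful and positive (`pos_comp_adj`). Two principles carry the argument. First, `𝔉`-positivity
survives products and multiplication by `a ⊗ ā` with `a` selfadjoint (`FPositive.mul`,
`FPositive.juxt_mul`, `FPositive.mul_juxt`). Second, an `𝔉`-positive 2-box that sends `1` to `0` is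
zero (`FPositive.eq_zero`), so the vanishing of such 2-boxes is tested on a single vector.

Supports: the sum of two positive eigenvectors is an eigenvector whose support dominates both, so a
largest `p` exists (`exists_isPMax`). If `y` is an eigenvector with support `p`, then `p ≤ C y`, so
`act x p` stays under `p`, and the second principle yields `(p ⊗ p̄) x = x_p` (`dbl_supp_mul`). The
same domination bounds `x_p ^ n` by a multiple of `r ^ n` (`exists_norm_cutDown_pow_le`). Hence `r`
cannot have a Jordan block, and the Abel limit `e` exists (`exists_abel_limit`). Its action is
positive and fixes `y`, so `ζ = act e p` is comparable with `y`: it is an eigenvector with support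
exactly `p` (`exists_maxSupportVector`).

Exchange algebra: conjugation by `ζ ^ (1/2)` turns `x` into `M = x_ζ` with `act M 1 = r p`. For `c`
in the exchange algebra, the relation `M (c ⊗ 1) = (c ⊗ 1) M` evaluated at `1` gives `act M c = r p
c`, and conjugating back gives an eigenvector of `x`. Conversely, an eigenvector `y` gives `c = ζ ^
(-1/2) y ζ ^ (-1/2)` with `act M c = r c`. The Kadison–Schwarz defect `act M (c²) - r c²` is the
value at `1` of the 2-box with Fourier transform `N M̂ N`, where `N = 1 ⊗ c - c̄ ⊗ 1`, so it is
positive. After conjugation by `ζ ^ (1/2)` it is trace-orthogonal to the rotated right eigenvector,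
and the condition on supports makes it vanish (`eq_zero_of_isRightPF`). Then `N M̂ N = 0`, hence `M̂
N = N M̂ = 0`, and these are the exchange relations (`mem_exchange_of_act_exchangeDefect`). -/

theorem shade_add (s : Bool) (a b : ℕ) : shade s (a + b) = shade (shade s a) b := by
  induction b with
  | zero => rfl
  | succ b ih => rw [← Nat.add_assoc, shade, shade, ih]

/-! ### Layers: one box between vertical strings -/

namespace PlanarCalculus

variable (P : PlanarCalculus.{u})

theorem recast_heq {s : Bool} {m n m' n' : ℕ} (hm : m = m') (hn : n = n') (f : P.Hom s m n) :
    HEq (P.recast hm hn f) f := by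
  subst hm hn; rfl

theorem tens_heq {s t t' : Bool} {m n m' n' k l k' l' : ℕ} (hm : shade s m = t)
    (hn : shade s n = t) (hk : shade s k = t') (hl : shade s l = t') {f : P.Hom s m n}
    {g : P.Hom t m' n'} {f' : P.Hom s k l} {g' : P.Hom t' k' l'} (h₁ : m = k) (h₂ : n = l)
    (h₃ : m' = k') (h₄ : n' = l') (hf : HEq f f') (hg : HEq g g') :
    HEq (P.tens hm hn f g) (P.tens hk hl f' g') := by
  subst hm h₁ h₂ h₃ h₄
  subst hk
  rw [eq_of_heq hf, eq_of_heq hg]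

/-- The layer that consists of `a` strings, the box `f` and `b` strings. -/
def layer (s : Bool) (a b M N : ℕ) {t : Bool} {m n : ℕ} (f : P.Hom t m n) (ha : shade s a = t)
    (hc : shade t m = shade t n) (hM : a + m + b = M) (hN : a + n + b = N) : P.Hom s M N :=
  P.recast hM hN (P.tens (t := shade t m) (by rw [shade_add, ha]) (by rw [shade_add, ha, hc])
    (P.tens ha ha (P.one s a) f) (P.one (shade t m) b))

theorem layer_heq {s : Bool} {a b M N : ℕ} {t : Bool} {m n : ℕ} (f : P.Hom t m n)
    (ha : shade s a = t) (hc : shade t m = shade t n) (hM : a + m + b = M) (hN : a + n + b = N) :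
    HEq (P.layer s a b M N f ha hc hM hN)
      (P.tens (t := shade t m) (by rw [shade_add, ha]) (by rw [shade_add, ha, hc])
        (P.tens ha ha (P.one s a) f) (P.one (shade t m) b)) :=
  P.recast_heq _ _ _

theorem layer_eq_tens {s : Bool} {a b : ℕ} {t v : Bool} {m n : ℕ} (f : P.Hom t m n)
    (ha : shade s a = t) (hc : shade t m = shade t n) (hv : shade t m = v) :
    P.layer s a b (a + m + b) (a + n + b) f ha hc rfl rfl =
      P.tens (t := v) (by rw [shade_add, ha, hv]) (by rw [shade_add, ha, ← hc, hv])
        (P.tens ha ha (P.one s a) f) (P.one v b) := by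
  subst hv; rfl

theorem layer_comp {s : Bool} {a b M N : ℕ} (K : ℕ) {t : Bool} {l m n : ℕ} (f : P.Hom t m n)
    (g : P.Hom t l m) (ha : shade s a = t) (hc : shade t l = shade t n)
    (hM : a + l + b = M) (hN : a + n + b = N) (hf : shade t m = shade t n) (hK : a + m + b = K) :
    P.layer s a b M N (P.comp f g) ha hc hM hN =
      P.comp (P.layer s a b K N f ha hf hK hN) (P.layer s a b M K g ha (hc.trans hf.symm) hM hK) := by
  subst hM hN hK
  have h : shade t m = shade t l := hf.trans hc.symm
  rw [P.layer_eq_tens (P.comp f g) ha hc rfl, P.layer_eq_tens f ha hf h,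
    P.layer_eq_tens g ha (hc.trans hf.symm) rfl, ← P.tens_comp, ← P.tens_comp, P.one_comp,
    P.one_comp]

theorem layer_one {s : Bool} {a b M : ℕ} {t : Bool} {m : ℕ} (ha : shade s a = t)
    (hM : a + m + b = M) : P.layer s a b M M (P.one t m) ha rfl hM hM = P.one s M := by
  subst hM
  simp only [layer, recast, P.one_tens_one]

theorem layer_heq_tens_one {s t : Bool} {m n b M N : ℕ} (f : P.Hom s m n) (hm : shade s m = t)
    (hn : shade s n = t) (hM : 0 + m + b = M) (hN : 0 + n + b = N) :
    HEq (P.tens hm hn f (P.one t b)) (P.layer s 0 b M N f (shade_zero s) (hm.trans hn.symm) hM hN)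
      := by
  subst hm
  refine HEq.trans ?_ (P.layer_heq f _ _ _ _).symm
  exact P.tens_heq _ _ _ _ (by omega) (by omega) rfl rfl (P.one_tens f).symm HEq.rfl

theorem layer_heq_one_tens {s t : Bool} {m n a M N : ℕ} (f : P.Hom t m n) (ha : shade s a = t)
    (hc : shade t m = shade t n) (hM : a + m + 0 = M) (hN : a + n + 0 = N) :
    HEq (P.tens ha ha (P.one s a) f) (P.layer s a 0 M N f ha hc hM hN) := by
  refine HEq.trans ?_ (P.layer_heq f _ _ _ _).symm
  rw [P.tens_one]

/-- All uses of `tens_assoc` are concentrated here. The two sides group their string counts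
differently, so the proof runs through `HEq`; the free counts `M` and `N` of `layer` let the result
be an honest equality. -/
theorem layer_layer {s t v : Bool} {a b a' b' M N M' N' m n : ℕ} (f : P.Hom v m n)
    (ha : shade s a = t) (ha' : shade t a' = v) (hc : shade v m = shade v n)
    (hM' : a' + m + b' = M') (hN' : a' + n + b' = N') (hM : a + M' + b = M)
    (hN : a + N' + b = N) (h : shade t M' = shade t N') :
    P.layer s a b M N (P.layer t a' b' M' N' f ha' hc hM' hN') ha h hM hN =
      P.layer s (a + a') (b' + b) M N f (by rw [shade_add, ha, ha']) hc (by omega) (by omega) := by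
  apply eq_of_heq
  refine (P.layer_heq _ _ _ _ _).trans (HEq.trans ?_ (P.layer_heq _ _ _ _ _).symm)
  subst hM' hN' hM hN
  have e : shade t (a' + m + b') = shade (shade v m) b' := by rw [shade_add, shade_add, ha']
  have k1 : shade s (a + (a' + m)) = shade v m := by simp only [shade_add, ha, ha']
  have k2 : shade s (a + (a' + n)) = shade v m := by simp only [shade_add, ha, ha', hc]
  have k3 : shade t (a' + m) = shade v m := by simp only [shade_add, ha']
  have k4 : shade t (a' + n) = shade v m := by simp only [shade_add, ha', hc]
  have k5 : shade s (a + a') = v := by simp only [shade_add, ha, ha']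
  have k6 : shade s (a + a' + m) = shade v m := by simp only [shade_add, ha, ha']
  have k7 : shade s (a + a' + n) = shade v m := by simp only [shade_add, ha, ha', hc]
  have k8 : shade s (a + (a' + m) + b') = shade (shade v m) b' := by simp only [shade_add, ha, ha']
  have k9 : shade s (a + (a' + n) + b') = shade (shade v m) b' := by
    simp only [shade_add, ha, ha', hc]
  have h1 : HEq (P.tens ha ha (P.one s a) (P.layer t a' b' _ _ f ha' hc rfl rfl))
      (P.tens k1 k2 (P.tens ha ha (P.one s a) (P.tens ha' ha' (P.one t a') f))
        (P.one (shade v m) b')) := by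
    refine HEq.trans ?_ (P.tens_assoc ha ha k3 k4 k1 k2 _ _ _).symm
    exact P.tens_heq _ _ _ _ rfl rfl rfl rfl HEq.rfl (P.layer_heq _ _ _ _ _)
  have h2 : HEq (P.tens ha ha (P.one s a) (P.tens ha' ha' (P.one t a') f))
      (P.tens k5 k5 (P.one s (a + a')) f) := by
    refine (P.tens_assoc ha ha ha' ha' k5 k5 _ _ _).symm.trans ?_
    rw [P.one_tens_one]
  refine (P.tens_heq (hk := k8) (hl := k9) (t' := shade (shade v m) b') _ _ (by omega) (by omega)
    rfl rfl h1
    (by rw [e]) (g' := P.one (shade (shade v m) b') b)).trans ?_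
  refine (P.tens_assoc k1 k2 rfl rfl k8 k9 _ _ _).trans ?_
  refine P.tens_heq _ _ _ _ (by omega) (by omega) rfl rfl h2 ?_
  rw [P.one_tens_one]

/-- Two boxes side by side can be moved past each other. -/
theorem layer_exch {s t t' : Bool} {a c M N K m n m' n' : ℕ} (b a₂ c₁ a₃ c₂ K' : ℕ)
    (f : P.Hom t m n) (g : P.Hom t' m' n') (ha : shade s a = t) (hc : shade t m = shade t n)
    (ha₂ : shade s a₂ = t') (hc' : shade t' m' = shade t' n') (h1 : a + m + c₁ = K)
    (h2 : a + n + c₁ = N) (h3 : a₂ + m' + c = M) (h4 : a₂ + n' + c = K)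
    (ea₂ : a + m + b = a₂) (ea₃ : a + n + b = a₃) (ec₂ : b + m' + c = c₂) (eK' : a₃ + m' + c = K') :
    P.comp (P.layer s a c₁ K N f ha hc h1 h2) (P.layer s a₂ c M K g ha₂ hc' h3 h4) =
      P.comp (P.layer s a₃ c K' N g
          (by rw [← ha₂, ← ea₂, ← ea₃]; simp only [shade_add, ha, hc]) hc' eK' (by omega))
        (P.layer s a c₂ M K' f ha hc (by omega) (by omega)) := by
  obtain rfl : c₁ = b + (n' + c) := by omega
  obtain rfl : c₂ = b + (m' + c) := by omega
  obtain rfl : M = a + m + b + (m' + c) := by omega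
  obtain rfl : K = a + m + b + (n' + c) := by omega
  obtain rfl : N = a + n + b + (n' + c) := by omega
  obtain rfl : K' = a + n + b + (m' + c) := by omega
  subst ea₂ ea₃
  have q3 : shade s (a + n + b) = t' := by rw [← ha₂]; simp only [shade_add, ha, hc]
  set f' := P.layer s a b _ _ f ha hc rfl rfl with hf'
  set g' := P.layer t' 0 c (m' + c) (n' + c) g (shade_zero t') hc' (by omega) (by omega) with hg'
  have hg'c : shade t' (m' + c) = shade t' (n' + c) := by simp only [shade_add, hc']
  -- Every layer of `f` is `f' ⊗ 1` and every layer of `g` is `1 ⊗ g'`, cut at the same vertical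
  -- line; the interchange law then makes both composites equal to `f' ⊗ g'`.
  have F : ∀ k M N (hM : a + m + (b + k) = M) (hN : a + n + (b + k) = N)
      (hM' : M = a + m + b + k) (hN' : N = a + n + b + k),
      P.layer s a (b + k) M N f ha hc hM hN = P.recast hM'.symm hN'.symm
        (P.tens ha₂ q3 f' (P.one t' k)) := by
    intro k M N hM hN hM' hN'
    apply eq_of_heq
    refine HEq.trans ?_ (P.recast_heq _ _ _).symm
    refine HEq.trans ?_ (P.layer_heq_tens_one f' ha₂ q3 (M := M) (N := N) (by omega)
      (by omega)).symm
    rw [hf', P.layer_layer]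
    congr 1
    omega
  have G : ∀ a₂ M N (ha₂ : shade s a₂ = t') (hM : a₂ + m' + c = M) (hN : a₂ + n' + c = N)
      (hM' : M = a₂ + (m' + c)) (hN' : N = a₂ + (n' + c)),
      P.layer s a₂ c M N g ha₂ hc' hM hN = P.recast hM'.symm hN'.symm
        (P.tens ha₂ ha₂ (P.one s a₂) g') := by
    intro a₂ M N ha₂ hM hN hM' hN'
    apply eq_of_heq
    refine HEq.trans ?_ (P.recast_heq _ _ _).symm
    refine HEq.trans ?_ (P.layer_heq_one_tens g' ha₂ hg'c (M := M) (N := N) (by omega)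
      (by omega)).symm
    rw [hg', P.layer_layer]
    rfl
  rw [F (n' + c) _ _ _ _ rfl rfl, F (m' + c) _ _ (by omega) (by omega) rfl rfl,
    G (a + m + b) _ _ ha₂ _ _ rfl rfl, G (a + n + b) _ _ q3 _ _ rfl rfl]
  simp only [recast]
  rw [← P.tens_comp, ← P.tens_comp]
  simp only [P.one_comp, P.comp_one]

theorem tens_eq_comp {s t : Bool} {m n m' n' : ℕ} (hm : shade s m = t) (hn : shade s n = t)
    (f : P.Hom s m n) (g : P.Hom t m' n') :
    P.tens hm hn f g = P.comp (P.tens hm hn f (P.one t n')) (P.tens hm hm (P.one s m) g) := by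
  rw [← P.tens_comp, P.comp_one, P.one_comp]

end PlanarCalculus

theorem shade_three (s : Bool) : shade s 3 = !s := by simp [shade]

theorem shade_not_three (s : Bool) : shade (!s) 3 = s := by simp [shade]

theorem shade_two_eq (s : Bool) : shade s 2 = shade s 0 := by simp [shade]

/-! ### Diagrams as stacks of layers, and the rules for rewriting them -/

namespace PlanarCalculus

variable (P : PlanarCalculus.{u})

/-- The layer `f`, with `a` strings on its left and `b` strings on its right, below `u`. -/
def ap {s t : Bool} {l m n M : ℕ} (a b N : ℕ) (f : P.Hom t m n) (u : P.Hom s l M)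
    (ha : shade s a = t := by
      with_reducible first
        | rfl
        | assumption
        | exact shade_one _
        | exact shade_not_one _
        | exact shade_two _
        | exact shade_three _
        | exact shade_not_three _
        | exact shade_zero _)
    (hc : shade t m = shade t n := by
      with_reducible first
        | rfl
        | assumption
        | exact shade_two_eq _
        | exact (shade_two_eq _).symm)
    (hM : a + m + b = M := by omega) (hN : a + n + b = N := by omega) : P.Hom s l N :=
  P.comp (P.layer s a b M N f ha hc hM hN) u

theorem ap_congr {s t : Bool} {l m n M a a' b b' N : ℕ} {f : P.Hom t m n} {u u' : P.Hom s l M}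
    (ha : shade s a = t) (ha' : shade s a' = t) (hc : shade t m = shade t n) (hM : a + m + b = M)
    (hM' : a' + m + b' = M) (hN : a + n + b = N) (hN' : a' + n + b' = N) (ea : a = a')
    (eb : b = b') (hu : u = u') :
    P.ap a b N f u ha hc hM hN = P.ap a' b' N f u' ha' hc hM' hN' := by
  subst ea eb hu; rfl

/-- `b` counts the strings between the two boxes. The explicit numbers do not occur on the left side
of the equation, so a rewrite has to supply them. Here the lower box is the left one; `ap_exch'`
treats the other case. -/
theorem ap_exch {s t t' : Bool} {a c M N K l m n m' n' : ℕ} {a₂ c₁ : ℕ} (b a₃ c₂ K' : ℕ)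
    (f : P.Hom t m n) (g : P.Hom t' m' n') (u : P.Hom s l M) (ha : shade s a = t)
    (hc : shade t m = shade t n)
    (ha₂ : shade s a₂ = t') (hc' : shade t' m' = shade t' n') (h1 : a + m + c₁ = K)
    (h2 : a + n + c₁ = N) (h3 : a₂ + m' + c = M) (h4 : a₂ + n' + c = K)
    (ea₂ : a + m + b = a₂) (ea₃ : a + n + b = a₃) (ec₂ : b + m' + c = c₂) (eK' : a₃ + m' + c = K') :
    P.ap a c₁ N f (P.ap a₂ c K g u ha₂ hc' h3 h4) ha hc h1 h2 =
      P.ap a₃ c N g (P.ap a c₂ K' f u ha hc (by omega) (by omega))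
        (by rw [← ha₂, ← ea₂, ← ea₃]; simp only [shade_add, ha, hc]) hc' eK' (by omega) := by
  simp only [ap, ← P.comp_assoc]
  rw [P.layer_exch b a₂ c₁ a₃ c₂ K' f g ha hc ha₂ hc' h1 h2 h3 h4 ea₂ ea₃ ec₂ eK']

theorem ap_exch' {s t t' : Bool} {a c M N K l m n m' n' : ℕ} {a₃ c₂ : ℕ} (b a₂ c₁ K' : ℕ)
    (f : P.Hom t m n) (g : P.Hom t' m' n') (u : P.Hom s l M) (ha : shade s a = t)
    (hc : shade t m = shade t n)
    (ha₃ : shade s a₃ = t') (hc' : shade t' m' = shade t' n') (h1 : a + m + c₂ = M)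
    (h2 : a + n + c₂ = K) (h3 : a₃ + m' + c = K) (h4 : a₃ + n' + c = N)
    (ea₃ : a + n + b = a₃) (ea₂ : a + m + b = a₂) (ec₁ : b + n' + c = c₁) (eK' : a + m + c₁ = K') :
    P.ap a₃ c N g (P.ap a c₂ K f u ha hc h1 h2) ha₃ hc' h3 h4 =
      P.ap a c₁ N f (P.ap a₂ c K' g u
        (by rw [← ha₃, ← ea₂, ← ea₃]; simp only [shade_add, ha, hc]) hc' (by omega) (by omega))
        ha hc eK' (by omega) := by
  rw [P.ap_exch b a₃ c₂ K f g u ha hc _ hc' _ _ _ _ ea₂ ea₃]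
  omega

theorem ap_zero {s t : Bool} {l m n M : ℕ} {a b N : ℕ} (u : P.Hom s l M) (ha : shade s a = t)
    (hc : shade t m = shade t n) (hM : a + m + b = M) (hN : a + n + b = N) :
    P.ap a b N (0 : P.Hom t m n) u ha hc hM hN = 0 := by
  subst hM hN
  rw [ap, P.layer_eq_tens _ ha hc rfl, map_zero, LinearMap.map_zero₂, LinearMap.map_zero₂]

theorem ap_comp {s t : Bool} {a b k l m n M N : ℕ} (K : ℕ) (f : P.Hom t m n) (g : P.Hom t l m)
    (u : P.Hom s k M) (ha : shade s a = t) (hc : shade t l = shade t n)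
    (hM : a + l + b = M) (hN : a + n + b = N) (hf : shade t m = shade t n) (hK : a + m + b = K) :
    P.ap a b N (P.comp f g) u ha hc hM hN =
      P.ap a b N f (P.ap a b K g u ha (hc.trans hf.symm) hM hK) ha hf hK hN := by
  rw [ap, P.layer_comp K f g ha hc hM hN hf hK, P.comp_assoc]; rfl

theorem ap_layer {s t v : Bool} {a b a' b' M N M' N' m n l : ℕ} (f : P.Hom v m n) (u : P.Hom s l M)
    (ha : shade s a = t) (ha' : shade t a' = v) (hc : shade v m = shade v n)
    (hM' : a' + m + b' = M') (hN' : a' + n + b' = N') (hM : a + M' + b = M)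
    (hN : a + N' + b = N) (h : shade t M' = shade t N') :
    P.ap a b N (P.layer t a' b' M' N' f ha' hc hM' hN') u ha h hM hN =
      P.ap (a + a') (b' + b) N f u (by rw [shade_add, ha, ha']) hc (by omega) (by omega) := by
  rw [ap, P.layer_layer]; rfl

/-- A layer inside a box that is itself placed between strings. -/
theorem ap_ap {s t v : Bool} {a b a' b' M N M' N' k m n l : ℕ} (a₂ b₂ K : ℕ) (f : P.Hom v m n)
    (g : P.Hom t k M')
    (u : P.Hom s l M)
    (ha : shade s a = t) (ha' : shade t a' = v) (hc : shade v m = shade v n)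
    (hM' : a' + m + b' = M') (hN' : a' + n + b' = N') (hM : a + k + b = M)
    (hN : a + N' + b = N) (h : shade t k = shade t N') (ea : a + a' = a₂) (eb : b' + b = b₂)
    (eK : a + M' + b = K) :
    P.ap a b N (P.ap a' b' N' f g ha' hc hM' hN') u ha h hM hN =
      P.ap a₂ b₂ N f (P.ap a b K g u ha
        (by rw [h, ← hM', ← hN']; simp only [shade_add, ha', hc]) hM eK)
        (by rw [← ea, shade_add, ha, ha']) hc (by omega) (by omega) := by
  subst ea eb
  rw [P.ap_layer f _ ha ha' hc hM' hN' eK hN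
    (by rw [← hM', ← hN']; simp only [shade_add, ha', hc]) |>.symm]
  rw [← P.ap_comp]
  rfl

theorem ap_one {s t : Bool} {a b m M l : ℕ} (u : P.Hom s l M) (ha : shade s a = t)
    (hM : a + m + b = M) : P.ap a b M (P.one t m) u ha rfl hM hM = u := by
  rw [ap, P.layer_one, P.one_comp]

theorem ap_zero_zero {s : Bool} {l m n : ℕ} (f : P.Hom s m n) (u : P.Hom s l m)
    (ha : shade s 0 = s) (hc : shade s m = shade s n) (hM : 0 + m + 0 = m) (hN : 0 + n + 0 = n) :
    P.ap 0 0 n f u ha hc hM hN = P.comp f u := by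
  have : P.layer s 0 0 m n f ha hc hM hN = f := by
    apply eq_of_heq
    refine (P.layer_heq_tens_one f hc rfl hM hN).symm.trans ?_
    rw [P.tens_one]
  rw [ap, this]

theorem ap_tens {s t v : Bool} {a b m n m' n' l M N : ℕ} (b' a' K : ℕ) (hm : shade t m = v)
    (hn : shade t n = v) (f : P.Hom t m n) (g : P.Hom v m' n') (u : P.Hom s l M)
    (ha : shade s a = t) (hc : shade t (m + m') = shade t (n + n'))
    (hM : a + (m + m') + b = M) (hN : a + (n + n') + b = N) (hc' : shade v m' = shade v n')
    (eb : n' + b = b') (ea : a + m = a') (eK : a' + n' + b = K) :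
    P.ap a b N (P.tens hm hn f g) u ha hc hM hN =
      P.ap a b' N f (P.ap a' b K g u (by rw [← ea, shade_add, ha, hm]) hc' (by omega) eK)
        ha (hm.trans hn.symm) (by omega) (by omega) := by
  subst eb ea eK
  have e1 : P.tens hm hn f (P.one v n') = P.layer t 0 n' _ _ f (shade_zero t) (hm.trans hn.symm)
      (by omega) (by omega) := eq_of_heq (P.layer_heq_tens_one f hm hn _ _)
  have e2 : P.tens hm hm (P.one t m) g = P.layer t m 0 _ _ g hm hc' (by omega) (by omega) :=
    eq_of_heq (P.layer_heq_one_tens g hm hc' _ _)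
  have k : shade t (m + n') = shade t (n + n') := by simp only [shade_add, hm, hn]
  rw [P.tens_eq_comp hm hn f g, P.ap_comp (a + m + n' + b) _ _ _ _ _ _ _ k (by omega), e1, e2,
    P.ap_layer, P.ap_layer]
  exact P.ap_congr _ _ _ _ _ _ _ (by omega) (by omega)
    (P.ap_congr _ _ _ _ _ _ _ (by omega) (by omega) rfl)

theorem ap_tens_one {s t v : Bool} {a b m n k l M N : ℕ} (b' : ℕ) (hm : shade t m = v)
    (hn : shade t n = v) (f : P.Hom t m n) (u : P.Hom s l M)
    (ha : shade s a = t) (hc : shade t (m + k) = shade t (n + k))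
    (hM : a + (m + k) + b = M) (hN : a + (n + k) + b = N) (eb : k + b = b') :
    P.ap a b N (P.tens hm hn f (P.one v k)) u ha hc hM hN =
      P.ap a b' N f u ha (hm.trans hn.symm) (by omega) (by omega) := by
  rw [P.ap_tens b' (a + m) M hm hn f _ u ha hc hM hN rfl eb rfl (by omega), P.ap_one]

theorem ap_one_tens {s t v : Bool} {a b m n k l M N : ℕ} (a' : ℕ) (hk : shade t k = v)
    (f : P.Hom v m n) (u : P.Hom s l M)
    (ha : shade s a = t) (hc : shade t (k + m) = shade t (k + n))
    (hM : a + (k + m) + b = M) (hN : a + (k + n) + b = N) (hc' : shade v m = shade v n)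
    (ea : a + k = a') :
    P.ap a b N (P.tens hk hk (P.one t k) f) u ha hc hM hN =
      P.ap a' b N f u (by rw [← ea, shade_add, ha, hk]) hc' (by omega) (by omega) := by
  rw [P.ap_tens (n + b) a' N hk hk _ f u ha hc hM hN hc' rfl ea (by omega), P.ap_one]

/-- Straightening of a zigzag. -/
theorem ap_cup_ap_cap {s t t' : Bool} {a a₁ b b₁ K M l : ℕ} (u : P.Hom s l M) (ha : shade s a = t)
    (ha₁ : shade s a₁ = t') (hc : shade t 2 = shade t 0) (hc' : shade t' 0 = shade t' 2)
    (h1 : a + 2 + b₁ = K) (h2 : a + 0 + b₁ = M) (h3 : a₁ + 0 + b = M) (h4 : a₁ + 2 + b = K)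
    (ea : a₁ = a + 1) :
    P.ap a b₁ M (P.cup t) (P.ap a₁ b K (P.cap t') u ha₁ hc' h3 h4) ha hc h1 h2 = u := by
  obtain rfl : t' = !t := by rw [← ha₁, ea, shade, ha]
  obtain rfl : b₁ = 1 + b := by omega
  obtain rfl : M = a + 1 + b := by omega
  obtain rfl : K = a + 3 + b := by omega
  subst ea
  have h := P.zigzag_left t
  have e1 : P.tens (shade_two t) (shade_zero t) (P.cup t) (P.one t 1) =
      P.layer t 0 1 3 1 (P.cup t) (shade_zero t) hc rfl rfl :=
    eq_of_heq (P.layer_heq_tens_one _ _ _ _ _)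
  have e2 : P.tens (shade_one t) (shade_one t) (P.one t 1) (P.cap (!t)) =
      P.layer t 1 0 1 3 (P.cap (!t)) (shade_one t) hc' rfl rfl :=
    eq_of_heq (P.layer_heq_one_tens _ _ _ _ _)
  rw [e1, e2] at h
  have := congrArg (fun f => P.ap a b (a + 1 + b) f u ha rfl rfl rfl) h
  rw [P.ap_one] at this
  have k : shade t 3 = shade t 1 := by simp [shade]
  rw [P.ap_comp (a + 3 + b) _ _ _ _ _ _ _ k rfl, P.ap_layer, P.ap_layer] at this
  rw [← this]
  exact P.ap_congr _ _ _ _ _ _ _ (by omega) (by omega)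
    (P.ap_congr _ _ _ _ _ _ _ (by omega) (by omega) this)

theorem ap_cup_ap_cap' {s t t' : Bool} {a a₁ b b₁ K M l : ℕ} (u : P.Hom s l M) (ha : shade s a = t)
    (ha₁ : shade s a₁ = t') (hc : shade t' 2 = shade t' 0) (hc' : shade t 0 = shade t 2)
    (h1 : a₁ + 2 + b = K) (h2 : a₁ + 0 + b = M) (h3 : a + 0 + b₁ = M) (h4 : a + 2 + b₁ = K)
    (ea : a₁ = a + 1) :
    P.ap a₁ b M (P.cup t') (P.ap a b₁ K (P.cap t) u ha hc' h3 h4) ha₁ hc h1 h2 = u := by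
  obtain rfl : t' = !t := by rw [← ha₁, ea, shade, ha]
  obtain rfl : b₁ = 1 + b := by omega
  obtain rfl : M = a + 1 + b := by omega
  obtain rfl : K = a + 3 + b := by omega
  subst ea
  have h := P.zigzag_right t
  have e1 : P.tens (shade_zero t) (shade_two t) (P.cap t) (P.one t 1) =
      P.layer t 0 1 1 3 (P.cap t) (shade_zero t) hc' rfl rfl :=
    eq_of_heq (P.layer_heq_tens_one _ _ _ _ _)
  have e2 : P.tens (shade_one t) (shade_one t) (P.one t 1) (P.cup (!t)) =
      P.layer t 1 0 3 1 (P.cup (!t)) (shade_one t) hc rfl rfl :=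
    eq_of_heq (P.layer_heq_one_tens _ _ _ _ _)
  rw [e1, e2] at h
  have := congrArg (fun f => P.ap a b (a + 1 + b) f u ha rfl rfl rfl) h
  rw [P.ap_one] at this
  have k : shade t 3 = shade t 1 := by simp [shade]
  rw [P.ap_comp (a + 3 + b) _ _ _ _ _ _ _ k rfl, P.ap_layer, P.ap_layer] at this
  rw [← this]
  exact P.ap_congr _ _ _ _ _ _ _ (by omega) (by omega)
    (P.ap_congr _ _ _ _ _ _ _ (by omega) (by omega) this)

end PlanarCalculus

/-! ### Rotation, Fourier transform and convolution as stacks of layers -/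

namespace CStarPlanarAlgebra

variable {P : CStarPlanarAlgebra.{u}}

/-- `bar` on rectangular diagrams. -/
def barHom {s t : Bool} (h : shade t 1 = s) (y : P.Hom s 1 1) : P.Hom t 1 1 := P.bar h y

/-- `fourier` on rectangular diagrams. -/
def fourierHom {s : Bool} (x : P.Hom s 2 2) : P.Hom (!s) 2 2 := P.fourier x

/-- `convL` on rectangular diagrams. -/
def convLHom {s : Bool} (y : P.Hom s 1 1) (w : P.Hom (!s) 2 2) : P.Hom s 1 1 := P.convL y w

/-- `convR` on rectangular diagrams. -/
def convRHom {s : Bool} (w : P.Hom (!s) 2 2) (z : P.Hom (!s) 1 1) : P.Hom (!s) 1 1 := P.convR w z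

theorem ap_bar {S s t : Bool} {l M : ℕ} {a b : ℕ} (a₁ b₁ K : ℕ) (h : shade t 1 = s)
    (y : P.Hom s 1 1) (u : P.Hom S l M) (ha : shade S a = t)
    (hM : a + 1 + b = M) (hM' : a + 1 + b = M)
    (ea : a + 1 = a₁) (eb : b + 1 = b₁) (eK : a + 3 + b = K) (ha₁ : shade S a₁ = s) :
    P.ap a b M (barHom h y) u ha rfl hM hM' =
      P.ap a b₁ M (P.cup t) (P.ap a₁ b₁ K y (P.ap a₁ b K (P.cap s) u)) := by
  have k31 : shade t 3 = shade t 1 := by simp [shade]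
  have c : shade s 2 = shade s 0 := shade_two_eq s
  unfold barHom bar
  rw [P.ap_comp K _ _ _ _ _ _ _ k31 (by omega),
    P.ap_comp K _ _ _ _ _ _ _ rfl (by omega),
    P.ap_tens_one b₁, P.ap_tens_one b₁, P.ap_one_tens a₁, P.ap_one_tens a₁] <;> omega

theorem ap_fourier {S s : Bool} {l M : ℕ} {a b : ℕ} (a₁ a₂ b₁ b₂ K : ℕ)
    (x : P.Hom s 2 2) (u : P.Hom S l M) (ha : shade S a = !s)
    (hM : a + 2 + b = M) (hM' : a + 2 + b = M)
    (ea : a + 1 = a₁) (ea₂ : a + 2 = a₂) (eb : b + 1 = b₁) (eb₂ : b + 2 = b₂)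
    (eK : a + 4 + b = K) (ha₁ : shade S a₁ = s) (ha₂ : shade S a₂ = !s) :
    P.ap a b M (fourierHom x) u ha rfl hM hM' =
      P.ap a b₂ M (P.cup (!s)) (P.ap a₁ b₁ K x (P.ap a₂ b K (P.cap (!s)) u)) := by
  have k31 : shade (!s) 4 = shade (!s) 2 := by simp [shade]
  have c := shade_two_eq (!s)
  have k3 : shade (!s) 3 = s := shade_not_three s
  have e : fourierHom x = P.comp (s := !s) (m := 4) (l := 2)
      (P.tens (shade_two (!s)) (shade_zero (!s)) (P.cup (!s)) (P.one (!s) 2))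
      (P.comp (s := !s) (m := 4) (l := 2)
        (P.tens (s := !s) (t := s) (m := 3) (n := 3) k3 k3
          (P.tens (s := !s) (t := s) (m := 1) (n := 1) (m' := 2) (n' := 2)
            (shade_not_one s) (shade_not_one s) (P.one (!s) 1) x) (P.one s 1))
        (P.tens (shade_two (!s)) (shade_two (!s)) (P.one (!s) 2) (P.cap (!s)))) := rfl
  rw [e, P.ap_comp K _ _ _ _ _ _ _ k31 (by omega),
    P.ap_comp K _ _ _ _ _ _ _ rfl (by omega),
    P.ap_tens_one b₂, P.ap_tens_one b₁, P.ap_one_tens a₁, P.ap_one_tens a₂] <;>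
    omega

theorem ap_convL {S s : Bool} {l M : ℕ} {a b : ℕ} (a₁ b₁ b₂ K : ℕ)
    (y : P.Hom s 1 1) (w : P.Hom (!s) 2 2) (u : P.Hom S l M) (ha : shade S a = s)
    (hM : a + 1 + b = M) (hM' : a + 1 + b = M)
    (ea : a + 1 = a₁) (eb : b + 1 = b₁) (eb₂ : b + 2 = b₂)
    (eK : a + 3 + b = K) (ha₁ : shade S a₁ = !s) :
    P.ap a b M (convLHom y w) u ha rfl hM hM' =
      P.ap a b₁ M (P.cup s) (P.ap a b₂ K y (P.ap a₁ b K w (P.ap a b₁ K (P.cap s) u))) := by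
  have k31 : shade s 3 = shade s 1 := by simp [shade]
  have c := shade_two_eq s
  unfold convLHom convL
  rw [P.ap_comp K _ _ _ _ _ _ _ k31 (by omega),
    P.ap_comp K _ _ _ _ _ _ _ rfl (by omega),
    P.ap_tens_one b₁, P.ap_tens b₂ a₁ K, P.ap_tens_one b₁] <;>
    omega

theorem ap_convR {S s : Bool} {l M : ℕ} {a b : ℕ} (a₁ a₂ b₁ K : ℕ)
    (w : P.Hom (!s) 2 2) (z : P.Hom (!s) 1 1) (u : P.Hom S l M) (ha : shade S a = !s)
    (hM : a + 1 + b = M) (hM' : a + 1 + b = M)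
    (ea : a + 1 = a₁) (ea₂ : a + 2 = a₂) (eb : b + 1 = b₁)
    (eK : a + 3 + b = K) (ha₁ : shade S a₁ = s) (ha₂ : shade S a₂ = !s) :
    P.ap a b M (convRHom w z) u ha rfl hM hM' =
      P.ap a₁ b M (P.cup s) (P.ap a b₁ K w (P.ap a₂ b K z (P.ap a₁ b K (P.cap s) u))) := by
  have k31 : shade (!s) 3 = shade (!s) 1 := by simp [shade]
  have c := shade_two_eq s
  unfold convRHom convR
  rw [P.ap_comp K _ _ _ _ _ _ _ k31 (by omega),
    P.ap_comp K _ _ _ _ _ _ _ rfl (by omega),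
    P.ap_one_tens a₁, P.ap_tens b₁ a₂ K, P.ap_one_tens a₁] <;>
    omega

/-- A box slides over a maximum from the left leg to the right one and arrives rotated: the maximum
and the cup in the definition of `bar` form a zigzag, which straightens. -/
theorem cap_bar {S s t : Bool} {l M N : ℕ} {a b : ℕ} (a₁ b₁ : ℕ) (h : shade t 1 = s)
    (y : P.Hom s 1 1) (u : P.Hom S l M) (ha : shade S a = s) (ha₁ : shade S a₁ = t)
    (hM : a + 0 + b = M) (hN : a + 2 + b = N) (ea : a + 1 = a₁) (eb : b + 1 = b₁) :
    P.ap a₁ b N (barHom h y) (P.ap a b N (P.cap s) u) = P.ap a b₁ N y (P.ap a b N (P.cap s) u) := by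
  have e2 : shade S (a + 2) = s := by rw [shade_add, ha, shade_two]
  rw [ap_bar (a + 2) (b + 1) (a + 4 + b) _ _ _ _ _ _ _ _ _ e2,
    P.ap_exch' 0 a (b + 2) N (P.cap s) (P.cap s),
    P.ap_exch' 0 a (b + 2) N (P.cap s) y, P.ap_cup_ap_cap']
  · exact P.ap_congr _ _ _ _ _ _ _ rfl eb rfl
  all_goals omega

theorem cup_bar_left {S s t : Bool} {l M N : ℕ} {a b : ℕ} (a₁ b₁ : ℕ) (h : shade t 1 = s)
    (y : P.Hom s 1 1) (u : P.Hom S l M) (ha : shade S a = t) (ha₁ : shade S a₁ = s)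
    (hM : a + 2 + b = M) (hN : a + 0 + b = N) (ea : a + 1 = a₁) (eb : b + 1 = b₁) :
    P.ap a b N (P.cup t) (P.ap a b₁ M (barHom h y) u) =
      P.ap a b N (P.cup t) (P.ap a₁ b M y u) := by
  have e2 : shade S (a + 2) = t := by rw [shade_add, ha, shade_two]
  rw [ap_bar a₁ (b + 2) (a + 4 + b) _ _ _ _ _ _ _ _ _ ha₁,
    P.ap_exch' 0 (a + 2) b M (P.cup t) (P.cup t), P.ap_exch' 0 (a + 2) b M y (P.cup t),
    P.ap_cup_ap_cap']
  all_goals omega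

/-- Bending the right string back with a cup recovers the box, by a zigzag. -/
theorem cap_injective {s : Bool} {w y : P.Hom s 1 1}
    (h : P.ap 0 1 2 w (P.cap s) = P.ap 0 1 2 y (P.cap s)) : w = y := by
  have key : ∀ y : P.Hom s 1 1, P.ap 1 0 1 (P.cup (!s))
      (P.ap 0 1 3 (P.ap 0 1 2 y (P.cap s)) (P.one s 1)) = y := by
    intro y
    rw [P.ap_ap 0 2 3, P.ap_exch' 0 1 0 1 y, P.ap_cup_ap_cap', P.ap_zero_zero, P.comp_one] <;> rfl
  rw [← key w, h, key y]

/-- Two `1`-boxes with the same closure by a cup are equal. -/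
theorem cup_injective {s : Bool} {w y : P.Hom s 1 1}
    (h : P.ap 0 0 0 (P.cup s) (P.ap 0 1 2 w (P.one s 2)) =
      P.ap 0 0 0 (P.cup s) (P.ap 0 1 2 y (P.one s 2))) : w = y := by
  have key : ∀ y : P.Hom s 1 1, P.ap 0 1 1 (P.ap 0 0 0 (P.cup s) (P.ap 0 1 2 y (P.one s 2)))
      (P.ap 1 0 3 (P.cap (!s)) (P.one s 1)) = y := by
    intro y
    rw [P.ap_ap 0 1 3, P.ap_ap 0 2 3, P.ap_one, P.ap_exch 0 1 0 1 y, P.ap_cup_ap_cap,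
      P.ap_zero_zero, P.comp_one] <;> rfl
  rw [← key w, h, key y]

end CStarPlanarAlgebra

/-! ### The rotation axiom for 1-boxes, and the action of a 2-box on functionals -/

namespace CStarPlanarAlgebra

variable {P : CStarPlanarAlgebra.{u}}

theorem bendUp_ap_cap {s : Bool} (y : P.Hom s 1 1) :
    P.bendUp (P.ap 0 1 2 y (P.cap s)) = barHom (shade_not_one s) y := by
  have e1 : P.recast (m' := 1 + (1 + 1)) (n' := 1) (by omega) (by omega)
      (P.tens (shade_two (!s)) (shade_zero (!s)) (P.cup (!s)) (P.one (!s) 1)) =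
      P.layer (!s) 0 1 3 1 (P.cup (!s)) (shade_zero _) (shade_two_eq _) rfl rfl :=
    eq_of_heq ((P.recast_heq _ _ _).trans (P.layer_heq_tens_one _ _ _ _ _))
  have e2 : P.tens (shade_not_one s) (shade_not_one s) (P.one (!s) 1) (P.ap 0 1 2 y (P.cap s)) =
      P.layer (!s) 1 0 1 3 (P.ap 0 1 2 y (P.cap s)) (shade_not_one _) (shade_two_eq _).symm rfl
        rfl :=
    eq_of_heq (P.layer_heq_one_tens _ _ _ _ _)
  have e3 := P.ap_zero_zero (barHom (shade_not_one s) y) (P.one (!s) 1) (shade_zero _) rfl rfl rfl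
  rw [P.comp_one] at e3
  rw [← e3, ap_bar 1 1 3 _ _ _ _ _ _ rfl rfl rfl (shade_not_one s), PlanarCalculus.bendUp, e1, e2]
  change _ = P.ap 0 1 1 (P.cup (!s)) (P.ap 1 1 3 y (P.ap 1 0 3 (P.cap s) (P.one (!s) 1)))
  have k := P.ap_ap (a := 1) (b := 0) (N := 3) 1 1 3 y (P.cap s) (P.one (!s) 1) (shade_not_one s)
    (shade_zero s) rfl rfl rfl rfl rfl (shade_two_eq _).symm rfl rfl rfl
  rw [← k]
  simp only [PlanarCalculus.ap, P.comp_one]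

/-- Once a 1-box is written with both strings at the bottom, one click is its rotation by `π`. This
links `bar` to the axiom on the rotation by `2 π`. -/
theorem click_ap_cap {s : Bool} (h : shade s 2 = s) (y : P.Hom s 1 1) :
    P.click (n := 1) h (P.ap 0 1 2 y (P.cap s)) =
      P.ap 0 1 2 (barHom (shade_not_one s) y) (P.cap (!s)) := by
  have e : ∀ (k : shade (!s) 1 = !(!s)) (g : P.Hom (!s) 1 1), P.bendDown k g =
      P.ap 0 1 2 g (P.cap (!s)) := by
    intro k g
    have e1 : P.tens (shade_one (!s)) k g (P.one (!(!s)) 1) =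
        P.layer (!s) 0 1 2 2 g (shade_zero _) rfl rfl rfl :=
      eq_of_heq (P.layer_heq_tens_one _ _ _ _ _)
    rw [PlanarCalculus.bendDown, e1]; rfl
  rw [PlanarCalculus.click, bendUp_ap_cap, e]

/-- Two clicks of a disc with two boundary points are the full rotation. The axiom `full_rotation`
enters the proof only here. -/
theorem barHom_barHom {s t : Bool} (h : shade t 1 = s) (h' : shade s 1 = t) (y : P.Hom s 1 1) :
    barHom h' (barHom h y) = y := by
  obtain rfl : t = !s := by rw [← h', shade_one]
  have hs : shade s 2 = s := shade_two s
  have e := P.full_rotation hs (P.ap 0 1 2 y (P.cap s))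
  have e1 : P.clicks hs (P.ap 0 1 2 y (P.cap s)) 2 =
      P.click (shade_two _) (P.click hs (P.ap 0 1 2 y (P.cap s))) := rfl
  change HEq (P.clicks hs (P.ap 0 1 2 y (P.cap s)) 2) _ at e
  rw [e1, click_ap_cap, click_ap_cap] at e
  -- `!!s` and `s` are not definitionally equal, so the colour is generalised before it is
  -- substituted.
  have key : ∀ v (hv : (!(!s)) = v) (k : shade v 1 = !s),
      HEq (P.ap 0 1 2 (barHom (shade_not_one (!s)) (barHom (shade_not_one s) y)) (P.cap (!(!s))))
        (P.ap 0 1 2 (barHom k (barHom (shade_not_one s) y)) (P.cap v)) := by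
    intro v hv k; subst hv; rfl
  exact cap_injective (eq_of_heq ((key s (Bool.not_not s) h').symm.trans e))

/-- In contrast to `cup_bar_left`, this slide around a minimum goes against the direction built into
`bar`, so it needs the involutivity of `bar`. -/
theorem cup_bar {S s t : Bool} {l M N : ℕ} {a b : ℕ} (a₁ b₁ : ℕ) (h : shade t 1 = s)
    (y : P.Hom s 1 1) (u : P.Hom S l M) (ha : shade S a = s) (ha₁ : shade S a₁ = t)
    (hM : a + 2 + b = M) (hN : a + 0 + b = N) (ea : a + 1 = a₁) (eb : b + 1 = b₁) :
    P.ap a b N (P.cup s) (P.ap a₁ b M (barHom h y) u) =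
      P.ap a b N (P.cup s) (P.ap a b₁ M y u) := by
  have h' : shade s 1 = t := by rw [← ha₁, ← ea, shade_add, ha]
  rw [← cup_bar_left a₁ b₁ h' (barHom h y) u ha ha₁ hM hN ea eb, barHom_barHom]

/-- Both sides represent `x` with its lower left string bent up on the left. -/
theorem cup_fourier {S s : Bool} {l M N : ℕ} {a b : ℕ} (a₁ b₁ : ℕ) (x : P.Hom s 2 2)
    (u : P.Hom S l M) (ha : shade S a = !s) (ha₁ : shade S a₁ = s)
    (hM : a + 3 + b = M) (hN : a + 1 + b = N) (ea : a + 1 = a₁) (eb : b + 1 = b₁) :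
    P.ap a₁ b N (P.cup s) (P.ap a b₁ M (fourierHom x) u) =
      P.ap a b₁ N (P.cup (!s)) (P.ap a₁ b M x u) := by
  have h2 : shade S (a + 2) = !s := by rw [shade_add, ha, shade_two]
  have h3 : shade S (a + 3) = s := by rw [shade_add, ha, shade_not_three]
  rw [ap_fourier a₁ (a + 2) (b + 2) (b + 3) (a + 5 + b) _ _ _ _ _ _ _ _ _ _ ha₁ h2,
    P.ap_exch' 1 (a + 3) b₁ M (P.cup (!s)) (P.cup s), P.ap_exch' 0 (a + 3) b M x (P.cup s),
    P.ap_cup_ap_cap']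
  all_goals omega

/-- `y * x̂` as the action of `x` on the functionals `∪ ∘ (y ⊗ 1)`. -/
theorem cup_convL {S s : Bool} {l M N : ℕ} {a b : ℕ} (b₁ : ℕ) (x : P.Hom s 2 2) (y : P.Hom s 1 1)
    (u : P.Hom S l M) (ha : shade S a = s)
    (hM : a + 2 + b = M) (hN : a + 0 + b = N) (eb : b + 1 = b₁) :
    P.ap a b N (P.cup s) (P.ap a b₁ M (convLHom y (fourierHom x)) u) =
      P.ap a b N (P.cup s) (P.ap a b₁ M y (P.ap a b M x u)) := by
  have h1 : shade S (a + 1) = !s := by rw [shade_add, ha, shade_one]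
  have h2 : shade S (a + 2) = s := by rw [shade_add, ha, shade_two]
  rw [ap_convL (a + 1) (b + 2) (b + 3) (a + 4 + b) _ _ _ _ _ _ _ _ _ _ h1,
    P.ap_exch' 0 (a + 2) b M (P.cup s) (P.cup s), P.ap_exch' 1 (a + 2) b₁ M y (P.cup s),
    cup_fourier (a + 2) b₁, P.ap_exch' 0 a (b + 2) M (P.cap s) x, P.ap_cup_ap_cap']
  all_goals omega

end CStarPlanarAlgebra

/-! ### How the Fourier transform treats products and 1-boxes on the legs -/

namespace CStarPlanarAlgebra

variable {P : CStarPlanarAlgebra.{u}}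

theorem convLHom_comp {s : Bool} (y : P.Hom s 1 1) (x x' : P.Hom s 2 2) :
    convLHom y (fourierHom (P.comp x x')) =
      convLHom (convLHom y (fourierHom x)) (fourierHom x') := by
  apply cup_injective
  rw [cup_convL 1, cup_convL 1, cup_convL 1, P.ap_comp 2] <;> rfl

theorem convLHom_one {s : Bool} (y : P.Hom s 1 1) :
    convLHom y (fourierHom (P.one s 2)) = y := by
  apply cup_injective
  rw [cup_convL 1, P.ap_one]; rfl

/-- The box `b̄` on the right leg slides around the cup to the left leg, below `y`, and becomes `b`.
-/
theorem convLHom_tens {s : Bool} (y a b : P.Hom s 1 1) :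
    convLHom y (fourierHom (P.tens (shade_one s) (shade_one s) a (barHom (shade_not_one s) b))) =
      P.comp b (P.comp y a) := by
  apply cup_injective
  rw [cup_convL 1, P.ap_tens 1 1 2, P.ap_exch 0 1 1 2 a, P.ap_exch 0 1 1 2 y, cup_bar 1 1,
    P.ap_comp 2, P.ap_comp 2] <;> rfl

/-- A box is the Fourier transform of `x` if it becomes `x` after bending a string. -/
theorem eq_fourierHom {s : Bool} {w : P.Hom (!s) 2 2} {x : P.Hom s 2 2}
    (h : P.ap 1 0 1 (P.cup s) (P.ap 0 1 3 w (P.one (!s) 3)) =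
      P.ap 0 1 1 (P.cup (!s)) (P.ap 1 0 3 x (P.one (!s) 3))) : fourierHom x = w := by
  have key : ∀ w : P.Hom (!s) 2 2,
      P.ap 0 1 2 (P.ap 1 0 1 (P.cup s) (P.ap 0 1 3 w (P.one (!s) 3))) (hc := by simp [shade])
      (P.ap 2 0 4 (P.cap (!s)) (P.one (!s) 2)) = w := by
    intro w
    rw [P.ap_ap 1 1 4, P.ap_ap 0 2 4, P.ap_one, P.ap_exch 0 2 0 2 w, P.ap_cup_ap_cap,
      P.ap_zero_zero, P.comp_one] <;> rfl
  rw [← key (fourierHom x), cup_fourier 1 1, ← h, key] <;> rfl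

theorem fourierHom_injective {s : Bool} {x y : P.Hom s 2 2} (h : fourierHom x = fourierHom y) :
    x = y := by
  have key : ∀ x : P.Hom s 2 2,
      P.ap 1 0 2 (P.ap 1 0 1 (P.cup s) (P.ap 0 1 3 (fourierHom x) (P.one (!s) 3)))
        (hc := by simp [shade]) (P.ap 0 2 4 (P.cap s) (P.one s 2)) = x := by
    intro x
    rw [cup_fourier 1 1, P.ap_ap 1 1 4, P.ap_ap 2 0 4, P.ap_one, P.ap_exch' 0 0 2 2 (P.cap s) x,
      P.ap_cup_ap_cap', P.ap_zero_zero, P.comp_one] <;> rfl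
  rw [← key x, h, key y]

/-- The box `1 ⊗ c`. -/
def idTens {s : Bool} (c : P.Hom s 1 1) : P.Hom (!s) 2 2 :=
  P.layer (!s) 1 0 2 2 c (shade_not_one s) rfl rfl rfl

/-- The box `c̄ ⊗ 1`. -/
def barTens {s : Bool} (c : P.Hom s 1 1) : P.Hom (!s) 2 2 :=
  P.layer (!s) 0 1 2 2 (barHom (shade_not_one s) c) (shade_zero _) rfl rfl rfl

/-- The clockwise quarter turn carries the top left leg of `x` to the top right leg of `x̂`. This
lemma and the next three cover the four legs; they turn the exchange relations into `x̂ (1 ⊗ c) = x̂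
(c̄ ⊗ 1)` and `(1 ⊗ c) x̂ = (c̄ ⊗ 1) x̂`. -/
theorem fourierHom_comp_tens_one {s : Bool} (x : P.Hom s 2 2) (c : P.Hom s 1 1) :
    fourierHom (P.comp x (P.tens (shade_one s) (shade_one s) c (P.one (!s) 1))) =
      P.comp (fourierHom x) (idTens c) := by
  apply eq_fourierHom
  rw [idTens, P.ap_comp 3, P.ap_comp 3, cup_fourier 1 1, P.ap_layer, P.ap_tens_one 1] <;> rfl

theorem fourierHom_tens_one_comp {s : Bool} (x : P.Hom s 2 2) (c : P.Hom s 1 1) :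
    fourierHom (P.comp (P.tens (shade_one s) (shade_one s) c (P.one (!s) 1)) x) =
      P.comp (fourierHom x) (barTens c) := by
  apply eq_fourierHom
  rw [barTens, P.ap_comp 3, P.ap_comp 3, cup_fourier 1 1, P.ap_layer, P.ap_tens_one 1,
    ← cup_bar_left 1 2, P.ap_exch 0 1 2 3 (barHom _ c) x] <;> rfl

theorem fourierHom_comp_one_tens {s : Bool} (x : P.Hom s 2 2) (c : P.Hom s 1 1) :
    fourierHom (P.comp x (P.tens (shade_one s) (shade_one s) (P.one s 1)
      (barHom (shade_not_one s) c))) = P.comp (idTens c) (fourierHom x) := by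
  apply eq_fourierHom
  rw [idTens, P.ap_comp 3, P.ap_comp 3, P.ap_layer, P.ap_one_tens 2, ← cup_fourier 1 1 x,
    P.ap_exch 0 2 1 3 (fourierHom x) (barHom _ c), cup_bar 2 1] <;> rfl

theorem fourierHom_one_tens_comp {s : Bool} (x : P.Hom s 2 2) (c : P.Hom s 1 1) :
    fourierHom (P.comp (P.tens (shade_one s) (shade_one s) (P.one s 1)
      (barHom (shade_not_one s) c)) x) = P.comp (barTens c) (fourierHom x) := by
  apply eq_fourierHom
  rw [barTens, P.ap_comp 3, P.ap_comp 3, P.ap_layer, P.ap_one_tens 2,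
    P.ap_exch' 0 1 0 1 (barHom _ c) (P.cup s), P.ap_exch 0 0 1 1 (P.cup (!s)) (barHom _ c),
    ← cup_fourier 1 1 x] <;> rfl

/-- The Fourier transform of a product is the coproduct. -/
theorem fourierHom_comp {s : Bool} (x x' : P.Hom s 2 2) :
    fourierHom (P.comp x x') = P.ap 1 1 2 (P.cup s) (P.ap 0 2 4 (fourierHom x)
      (P.ap 2 0 4 (fourierHom x') (P.ap 1 1 4 (P.cap s) (P.one (!s) 2)))) := by
  apply eq_fourierHom
  have k := shade_three (!s)
  rw [P.ap_ap 1 2 5, P.ap_ap 0 3 5, P.ap_ap 2 1 5, P.ap_ap 1 2 3, P.ap_one,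
    P.ap_exch' 0 3 0 3 (P.cup s) (P.cup s), P.ap_exch' 1 3 1 3 (fourierHom x) (P.cup s),
    cup_fourier 3 1, P.ap_exch' 0 1 2 3 (P.cap s) x', P.ap_cup_ap_cap', cup_fourier 1 1,
    P.ap_comp 3] <;> rfl

/-- Dual to `cup_convL`: the right convolution is the action of `x` on the vectors `(1 ⊗ z) ∘ ∩`.
The two together make the convolutions adjoint under the trace. -/
theorem cap_convR {s : Bool} (x : P.Hom s 2 2) (z : P.Hom (!s) 1 1) :
    P.ap 1 0 2 (convRHom (fourierHom x) z) (P.ap 0 0 2 (P.cap s) (P.one s 0)) =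
      P.ap 0 0 2 x (P.ap 1 0 2 z (P.ap 0 0 2 (P.cap s) (P.one s 0))) := by
  rw [ap_convR 2 3 1 4, cup_fourier 2 1, P.ap_exch' 0 0 2 2 (P.cap s) (P.cap s),
    P.ap_exch' 1 1 2 2 (P.cap s) z, P.ap_exch' 0 0 2 2 (P.cap s) x, P.ap_cup_ap_cap'] <;>
    first | rfl | exact shade_two s | exact shade_three s

end CStarPlanarAlgebra

/-! ### Diagrams of the form `V V⋆`, and closures -/

namespace CStarPlanarAlgebra

variable {P : CStarPlanarAlgebra.{u}}

theorem adj_one (s : Bool) (n : ℕ) : P.adj (P.one s n) = P.one s n := star_one (P.Box s n)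

theorem adj_cap (s : Bool) : P.adj (P.cap s) = P.cup s := by rw [← P.adj_cup, P.adj_adj]

theorem adj_layer {s t : Bool} {a b M N m n : ℕ} (f : P.Hom t m n) (ha : shade s a = t)
    (hc : shade t m = shade t n) (hM : a + m + b = M) (hN : a + n + b = N) :
    P.adj (P.layer s a b M N f ha hc hM hN) = P.layer s a b N M (P.adj f) ha hc.symm hN hM := by
  subst hM hN
  rw [P.layer_eq_tens f ha hc rfl, P.layer_eq_tens (P.adj f) ha hc.symm hc.symm, P.adj_tens,
    P.adj_tens, adj_one, adj_one]

/-- Half of the convolution of a positive `1`-box with a positive `2`-box. -/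
def convHalf {s : Bool} (a : P.Hom s 1 1) (b : P.Hom (!s) 2 2) : P.Hom s 3 1 :=
  P.comp (P.layer s 0 1 3 1 (P.cup s) (shade_zero _) (shade_two_eq s) rfl rfl)
    (P.comp (P.layer s 0 2 3 3 a (shade_zero _) rfl rfl rfl)
      (P.layer s 1 0 3 3 b (shade_one _) rfl rfl rfl))

theorem comp_layer {s t : Bool} {l a b M N m n : ℕ} (f : P.Hom t m n) (u : P.Hom s l M)
    (ha : shade s a = t) (hc : shade t m = shade t n) (hM : a + m + b = M) (hN : a + n + b = N) :
    P.comp (P.layer s a b M N f ha hc hM hN) u = P.ap a b N f u ha hc hM hN := rfl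

/-- Once `a⋆` slides past `b`, the diagram is symmetric about its horizontal midline; the halves are
`convHalf a b` and its reflection. -/
theorem convLHom_sq {s : Bool} (a : P.Hom s 1 1) (b : P.Hom (!s) 2 2) :
    convLHom (P.comp a (P.adj a)) (P.comp b (P.adj b)) =
      P.comp (convHalf a b) (P.adj (convHalf a b)) := by
  rw [← P.comp_one (P.comp (convHalf a b) _), ← P.comp_one (convLHom _ _),
    ← P.ap_zero_zero (convLHom _ _) _ (shade_zero s) rfl rfl rfl, ap_convL 1 1 2 3,
    P.ap_comp 3, P.ap_comp 3]
  simp only [convHalf, P.adj_comp, adj_layer, P.adj_cup, P.comp_assoc]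
  simp only [comp_layer]
  rw [P.ap_exch 0 1 2 3 (P.adj a) b, P.ap_exch 0 1 2 3 (P.adj a) (P.adj b)]
  all_goals rfl

/-- Half of the coproduct of two positive `2`-boxes. -/
def coprodHalf {s : Bool} (b d : P.Hom (!s) 2 2) : P.Hom (!s) 4 2 :=
  P.comp (P.layer (!s) 1 1 4 2 (P.cup s) (shade_not_one _) (shade_two_eq s) rfl rfl)
    (P.comp (P.layer (!s) 0 2 4 4 b (shade_zero _) rfl rfl rfl)
      (P.layer (!s) 2 0 4 4 d (shade_two _) rfl rfl rfl))

theorem coprod_sq {s : Bool} (b d : P.Hom (!s) 2 2) :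
    P.ap 1 1 2 (P.cup s) (P.ap 0 2 4 (P.comp b (P.adj b))
      (P.ap 2 0 4 (P.comp d (P.adj d)) (P.ap 1 1 4 (P.cap s) (P.one (!s) 2)))) =
      P.comp (coprodHalf b d) (P.adj (coprodHalf b d)) := by
  rw [← P.comp_one (P.comp (coprodHalf b d) _), P.ap_comp 4, P.ap_comp 4]
  simp only [coprodHalf, P.adj_comp, adj_layer, P.adj_cup, P.comp_assoc]
  simp only [comp_layer]
  rw [P.ap_exch 0 2 2 4 (P.adj b) d, P.ap_exch 0 2 2 4 (P.adj b) (P.adj d)]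
  all_goals rfl

theorem convHalf_one_injective {s : Bool} {b : P.Hom (!s) 2 2}
    (h : convHalf (P.one s 1) b = 0) : b = 0 := by
  have k : shade s 3 = shade s 1 := by simp [shade]
  have key : P.ap 1 0 2 (convHalf (P.one s 1) b) (P.ap 0 2 4 (P.cap (!s)) (P.one (!s) 2)) =
      b := by
    have e : convHalf (P.one s 1) b = P.ap 0 1 1 (P.cup s) (P.ap 1 0 3 b (P.one s 3)) := by
      rw [← P.comp_one (convHalf _ _)]
      simp only [convHalf, P.comp_assoc]
      simp only [comp_layer, P.ap_one]
    rw [e, P.ap_ap 1 1 4, P.ap_ap 2 0 4, P.ap_one, P.ap_exch' 0 0 2 2 (P.cap (!s)) b,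
      P.ap_cup_ap_cap', P.ap_zero_zero, P.comp_one] <;> rfl
  rw [← key, h, P.ap_zero]

/-- A box with two more strings at the top than at the bottom, with its last top string bent
down. -/
def bendTop {t : Bool} {n : ℕ} (V : P.Hom t (n + 2) n) : P.Hom t (n + 1) (n + 1) :=
  P.comp (P.layer t 0 1 (n + 3) (n + 1) V (shade_zero _) (by simp [shade]) (by omega) (by omega))
    (P.layer t (n + 1) 0 (n + 1) (n + 3) (P.cap (shade t (n + 1))) rfl (shade_two_eq _).symm
      (by omega) (by omega))

/-- This brings a rectangular `V` within reach of `tr_pos`, which speaks of square boxes only.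
Closing the last string leaves two zigzags, one next to `V` and one next to `V⋆`, and both
straighten. -/
theorem closeLast_bendTop {t : Bool} {n : ℕ} (V : P.Hom t (n + 2) n) :
    P.closeLast (P.comp (bendTop V) (P.adj (bendTop V))) = P.comp V (P.adj V) := by
  have hV : shade t (n + 2) = shade t n := by simp [shade]
  have h3 : shade t (n + 3) = shade t (n + 1) := by simp [shade]
  have e : ∀ f : P.Hom t (n + 1) (n + 1), P.closeLast f = P.ap n 0 n (P.cup (shade t n))
      (P.ap 0 1 (n + 2) f (P.ap n 0 (n + 2) (P.cap (shade t n)) (P.one t n))) := by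
    intro f
    have e1 : P.tens (t := shade t n) rfl rfl (P.one t n) (P.cup (shade t n)) =
        P.layer t n 0 (n + 2) n (P.cup (shade t n)) rfl (shade_two_eq _) rfl rfl :=
      eq_of_heq (P.layer_heq_one_tens _ _ _ _ _)
    have e2 : P.tens (t := shade t n) rfl rfl (P.one t n) (P.cap (shade t n)) =
        P.layer t n 0 n (n + 2) (P.cap (shade t n)) rfl (shade_two_eq _).symm rfl rfl :=
      eq_of_heq (P.layer_heq_one_tens _ _ _ _ _)
    have e3 : P.tens (t := shade t (n + 1)) rfl rfl f (P.one (shade t (n + 1)) 1) =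
        P.layer t 0 1 (n + 2) (n + 2) f (shade_zero _) rfl (by omega) (by omega) :=
      eq_of_heq (P.layer_heq_tens_one _ _ _ _ _)
    rw [PlanarCalculus.closeLast, e1, e2, e3]
    simp only [PlanarCalculus.ap, P.comp_one]
  rw [e]
  simp only [bendTop, P.adj_comp, adj_layer, adj_cap]
  rw [P.ap_comp (n + 2), P.ap_comp (n + 4), P.ap_comp (n + 4), P.ap_layer, P.ap_layer, P.ap_layer,
    P.ap_layer, P.ap_exch' 0 (n + 2) 0 (n + 2) V (P.cup (shade t n)), P.ap_cup_ap_cap',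
    P.ap_exch 0 (n + 2) 0 (n + 2) (P.adj V) (P.cap (shade t n)), P.ap_cup_ap_cap, P.ap_zero_zero,
    P.ap_zero_zero, P.comp_one]
  all_goals first | omega | assumption | rfl

theorem bendTop_injective {t : Bool} {n : ℕ} {V : P.Hom t (n + 2) n} (h : bendTop V = 0) :
    V = 0 := by
  have hV : shade t (n + 2) = shade t n := by simp [shade]
  have h1 : shade t (n + 1 + 1) = shade t n := by simp [shade]
  have key : P.ap n 0 n (P.cup (shade t n)) (P.ap 0 1 (n + 2) (bendTop V) (P.one t (n + 2))) =
      V := by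
    rw [bendTop, P.ap_comp (n + 4), P.ap_layer, P.ap_layer,
      P.ap_exch' 0 (n + 2) 0 (n + 2) V (P.cup (shade t n)), P.ap_cup_ap_cap', P.ap_zero_zero,
      P.comp_one]
    all_goals first | omega | assumption | rfl | simp [shade]
  rw [← key, h, P.ap_zero]
  exact map_zero _

theorem closure_bendTop {t : Bool} {n : ℕ} (V : P.Hom t (n + 2) n) :
    P.closure (P.comp V (P.adj V)) = P.closure (P.comp (bendTop V) (P.adj (bendTop V))) := by
  rw [← closeLast_bendTop]
  cases n <;> rfl

theorem re_tr_comp_adj_pos {t : Bool} {n : ℕ} {V : P.Hom t (n + 2) n} (hV : V ≠ 0) :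
    0 < (P.tr₀ t (P.closure (P.comp V (P.adj V)))).re := by
  have h : P.adj (bendTop V) ≠ 0 := by
    intro h
    apply hV
    apply bendTop_injective
    rw [← P.adj_adj (bendTop V), h, map_zero]
  have := (P.tr_pos _ h).1
  rwa [P.adj_adj, ← closure_bendTop] at this

theorem closure_one {s : Bool} (a : P.Hom s 1 1) : P.closure a = P.ap 0 0 0 (P.cup s)
    (P.ap 0 1 2 a (P.ap 0 0 2 (P.cap s) (P.one s 0))) := by
  have e1 : P.tens (t := s) (shade_zero s) (shade_zero s) (P.one s 0) (P.cup s) =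
      P.layer s 0 0 2 0 (P.cup s) (shade_zero s) (shade_two_eq _) rfl rfl :=
    eq_of_heq (P.layer_heq_one_tens _ _ _ _ _)
  have e2 : P.tens (t := s) (shade_zero s) (shade_zero s) (P.one s 0) (P.cap s) =
      P.layer s 0 0 0 2 (P.cap s) (shade_zero s) (shade_two_eq _).symm rfl rfl :=
    eq_of_heq (P.layer_heq_one_tens _ _ _ _ _)
  have e3 : P.tens (t := shade s 1) rfl rfl a (P.one (shade s 1) 1) =
      P.layer s 0 1 2 2 a (shade_zero _) rfl rfl rfl :=
    eq_of_heq (P.layer_heq_tens_one _ _ _ _ _)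
  change P.comp (P.tens (t := s) (shade_zero s) (shade_zero s) (P.one s 0) (P.cup s))
    (P.comp (P.tens (t := shade s 1) rfl rfl a (P.one (shade s 1) 1))
      (P.tens (t := s) (shade_zero s) (shade_zero s) (P.one s 0) (P.cap s))) = _
  rw [e1, e2, e3]
  simp only [PlanarCalculus.ap, P.comp_one]

/-- The closure of `1`-boxes is tracial. -/
theorem closure_comp_comm {s : Bool} (a b : P.Hom s 1 1) :
    P.closure (P.comp a b) = P.closure (P.comp b a) := by
  rw [closure_one, closure_one, P.ap_comp 2, P.ap_comp 2, ← cap_bar 1 1 (shade_not_one s) b,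
    P.ap_exch 0 1 1 2 a, cup_bar 1 1] <;> rfl

/-- The convolutions by `x̂` on the left and on the right are adjoint to each other. -/
theorem closure_convLHom {s : Bool} (x : P.Hom s 2 2) (y : P.Hom s 1 1) (z : P.Hom (!s) 1 1) :
    P.closure (P.comp (convLHom y (fourierHom x)) (barHom (shade_one s) z)) =
      P.closure (P.comp y (barHom (shade_one s) (convRHom (fourierHom x) z))) := by
  have e : ∀ w : P.Hom (!s) 1 1,
      P.ap 0 1 2 (barHom (shade_one s) w) (P.ap 0 0 2 (P.cap s) (P.one s 0)) =
        P.ap 1 0 2 w (P.ap 0 0 2 (P.cap s) (P.one s 0)) := by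
    intro w
    rw [← cap_bar 1 1 (shade_not_one s), barHom_barHom] <;> rfl
  rw [closure_one, closure_one, P.ap_comp 2, P.ap_comp 2, cup_convL 1, e, e, cap_convR] <;> rfl

end CStarPlanarAlgebra

/-! ### Positivity, supports and functional calculus in C⋆-algebras -/

theorem finite_spectrum_of_finiteDimensional {A : Type*} [Ring A] [Algebra ℝ A]
    [FiniteDimensional ℝ A] (a : A) : (spectrum ℝ a).Finite := by
  refine (Module.End.finite_spectrum (Algebra.lmul ℝ A a)).subset fun r hr => ?_
  rw [spectrum.mem_iff] at hr ⊢
  intro h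
  apply hr
  rw [← Algebra.lmul_isUnit_iff (R := ℝ)]
  rw [map_sub, AlgHom.commutes]
  exact h

namespace CStarPlanarAlgebra

section CStar

variable {A : Type*} [CStarAlgebra A]

theorem pos_iff_nonneg [PartialOrder A] [StarOrderedRing A] {a : A} : Pos a ↔ 0 ≤ a :=
  CStarAlgebra.nonneg_iff_eq_mul_star_self.symm

theorem pos_zero : Pos (0 : A) := ⟨0, by simp⟩

theorem Pos.isSelfAdjoint {a : A} (h : Pos a) : IsSelfAdjoint a := by
  obtain ⟨b, rfl⟩ := h
  exact IsSelfAdjoint.mul_star_self b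

theorem Pos.conj {a : A} (h : Pos a) (c : A) : Pos (c * a * star c) := by
  obtain ⟨b, rfl⟩ := h
  exact ⟨c * b, by simp only [star_mul, mul_assoc]⟩

theorem Pos.conj_self {a c : A} (h : Pos a) (hc : IsSelfAdjoint c) : Pos (c * a * c) := by
  have := h.conj c
  rwa [hc.star_eq] at this

theorem Pos.add {a b : A} (ha : Pos a) (hb : Pos b) : Pos (a + b) := by
  let _ := CStarAlgebra.spectralOrder A
  have := CStarAlgebra.spectralOrderedRing A
  rw [pos_iff_nonneg] at *
  exact add_nonneg ha hb

theorem Pos.smul {a : A} (ha : Pos a) {r : ℝ} (hr : 0 ≤ r) : Pos ((r : ℂ) • a) := by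
  obtain ⟨b, rfl⟩ := ha
  refine ⟨((√r : ℝ) : ℂ) • b, ?_⟩
  rw [star_smul, smul_mul_smul_comm]
  congr 1
  simp only [RCLike.star_def, Complex.conj_ofReal]
  rw [← Complex.ofReal_mul, Real.mul_self_sqrt hr]

theorem isClosed_pos : IsClosed {a : A | Pos a} := by
  let _ := CStarAlgebra.spectralOrder A
  have := CStarAlgebra.spectralOrderedRing A
  simp only [pos_iff_nonneg]
  exact CStarAlgebra.isClosed_nonneg

theorem eq_zero_of_pos_of_pos_neg {a : A} (ha : Pos a) (hb : Pos (-a)) : a = 0 := by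
  let _ := CStarAlgebra.spectralOrder A
  have := CStarAlgebra.spectralOrderedRing A
  rw [pos_iff_nonneg] at *
  exact le_antisymm (neg_nonneg.1 hb) ha

theorem Pos.mul_eq_zero {a c : A} (ha : Pos a) (h : star c * a * c = 0) : a * c = 0 := by
  obtain ⟨b, rfl⟩ := ha
  have : star (star b * c) * (star b * c) = 0 := by
    rw [← h]; simp only [star_mul, star_star, mul_assoc]
  rw [mul_assoc, (CStarRing.star_mul_self_eq_zero_iff _).1 this, mul_zero]

theorem pos_cfc {f : ℝ → ℝ} (a : A) (hf : ∀ t ∈ spectrum ℝ a, 0 ≤ f t) : Pos (cfc f a) := by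
  let _ := CStarAlgebra.spectralOrder A
  have := CStarAlgebra.spectralOrderedRing A
  rw [pos_iff_nonneg]
  exact cfc_nonneg hf

theorem Pos.spectrum_nonneg {a : A} (ha : Pos a) {t : ℝ} (ht : t ∈ spectrum ℝ a) : 0 ≤ t := by
  let _ := CStarAlgebra.spectralOrder A
  have := CStarAlgebra.spectralOrderedRing A
  exact spectrum_nonneg_of_nonneg (pos_iff_nonneg.1 ha) ht

/-- Positivity can be tested with a faithful positive functional. -/
theorem pos_of_functional {h : A} (hh : IsSelfAdjoint h) (φ : A →ₗ[ℂ] ℂ)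
    (h1 : ∀ u, 0 ≤ (φ (u * h * star u)).re) (h2 : ∀ a, a ≠ 0 → 0 < (φ (a * star a)).re) :
    Pos h := by
  have hc : ∀ f : ℝ → ℝ, IsSelfAdjoint (cfc f h) := fun f => cfc_predicate f h
  set v := cfc (fun t : ℝ => max (-t) 0) h with hv
  -- The test element is the square root of the negative part `v` of `h`; it gives `u h u⋆ = -v²`,
  -- which contradicts faithfulness unless `v = 0`.
  have hu : cfc (fun t : ℝ => √(max (-t) 0)) h * h * star (cfc (fun t : ℝ => √(max (-t) 0)) h) =
      -(v * star v) := by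
    rw [(hc _).star_eq, (hc _).star_eq]
    nth_rw 2 [← cfc_id' ℝ h]
    rw [← cfc_mul .., ← cfc_mul .., hv, ← cfc_mul .., ← cfc_neg]
    refine cfc_congr fun t _ => ?_
    rcases le_total t 0 with ht | ht
    · have e : max (-t) 0 = -t := max_eq_left (by linarith)
      have := Real.mul_self_sqrt (show 0 ≤ -t by linarith)
      simp only [e]
      linear_combination t * this
    · have e : max (-t) 0 = 0 := max_eq_right (by linarith)
      simp [e]
  have hv0 : v = 0 := by
    by_contra hne
    have k1 := h1 (cfc (fun t : ℝ => √(max (-t) 0)) h)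
    have k2 := h2 v hne
    rw [hu, map_neg, Complex.neg_re] at k1
    linarith
  have : h = cfc (fun t : ℝ => max t 0) h := by
    have e : cfc (fun t : ℝ => max t 0 - max (-t) 0) h = h := by
      conv_rhs => rw [← cfc_id' ℝ h]
      refine cfc_congr fun t _ => ?_
      rcases le_total t 0 with ht | ht
      · simp [ht]
      · simp [ht]
    rw [cfc_sub .., ← hv, hv0, sub_zero] at e
    exact e.symm
  rw [this]
  exact pos_cfc _ fun t _ => le_max_right _ _

/-- The inverse of a selfadjoint element on its support. -/
def pinv (a : A) : A := cfc (fun t : ℝ => t⁻¹) a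

section FiniteDimensional

variable [FiniteDimensional ℂ A]

/-- The spectrum is finite, so the calculus also accepts the functions `t ↦ t⁻¹` and `1_{t ≠ 0}`,
which are discontinuous at `0`. -/
theorem continuousOn_spectrum (f : ℝ → ℝ) (a : A) : ContinuousOn f (spectrum ℝ a) := by
  have : FiniteDimensional ℝ A := FiniteDimensional.trans ℝ ℂ A
  exact (finite_spectrum_of_finiteDimensional a).continuousOn f

theorem cfc_mul_cfc (f g : ℝ → ℝ) (a : A) :
    cfc f a * cfc g a = cfc (fun t => f t * g t) a :=
  (cfc_mul f g a (continuousOn_spectrum f a) (continuousOn_spectrum g a)).symm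

/-- The support projection of a selfadjoint element. -/
def supp (a : A) : A := cfc (fun t : ℝ => if t = 0 then 0 else 1) a

theorem isStarProjection_supp (a : A) : IsStarProjection (supp a) := by
  refine ⟨?_, cfc_predicate _ a⟩
  rw [IsIdempotentElem, supp, cfc_mul_cfc]
  refine cfc_congr fun t _ => ?_
  by_cases h : t = 0 <;> simp [h]

theorem mul_pinv {a : A} (ha : IsSelfAdjoint a) : a * pinv a = supp a := by
  nth_rw 1 [← cfc_id' ℝ a]
  rw [pinv, cfc_mul_cfc]
  refine cfc_congr fun t _ => ?_
  by_cases h : t = 0 <;> simp [h]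

theorem supp_mul {a : A} (ha : IsSelfAdjoint a) : supp a * a = a := by
  nth_rw 2 [← cfc_id' ℝ a]
  rw [supp, cfc_mul_cfc]
  conv_rhs => rw [← cfc_id' ℝ a]
  refine cfc_congr fun t _ => ?_
  by_cases h : t = 0 <;> simp [h]

theorem isRangeProj_supp {a : A} (ha : IsSelfAdjoint a) : IsRangeProj a (supp a) := by
  refine ⟨isStarProjection_supp a, supp_mul ha, fun q _ h => ?_⟩
  rw [← mul_pinv ha, ← mul_assoc, h]

theorem IsRangeProj.eq_supp {a q : A} (ha : IsSelfAdjoint a) (h : IsRangeProj a q) :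
    q = supp a := by
  have h1 := h.2.2 _ (isStarProjection_supp a) (supp_mul ha)
  have h2 := (isRangeProj_supp ha).2.2 _ h.1 h.2.1
  have h3 := congrArg star h1
  rw [star_mul, h.1.isSelfAdjoint.star_eq, (isStarProjection_supp a).isSelfAdjoint.star_eq] at h3
  rw [← h3, h2]

/-- The support of a positive element is dominated by the element. -/
theorem exists_pos_smul_sub_supp {a : A} (ha : Pos a) :
    ∃ C : ℝ, 0 ≤ C ∧ Pos ((C : ℂ) • a - supp a) := by
  have : FiniteDimensional ℝ A := FiniteDimensional.trans ℝ ℂ A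
  -- `C` bounds the inverses of the finitely many spectral values; the maximum with `0` makes the
  -- constant nonnegative.
  obtain ⟨C, hC⟩ := ((finite_spectrum_of_finiteDimensional a).image (fun t : ℝ => t⁻¹)).bddAbove
  refine ⟨max C 0, le_max_right _ _, ?_⟩
  have e : ((max C 0 : ℝ) : ℂ) • a = cfc (fun t : ℝ => max C 0 * t) a := by
    rw [cfc_const_mul _ _ a, cfc_id' ℝ a ha.isSelfAdjoint, Complex.coe_smul]
  rw [e, supp, ← cfc_sub _ _ a (continuousOn_spectrum _ a) (continuousOn_spectrum _ a)]
  refine pos_cfc _ fun t ht => ?_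
  by_cases h : t = 0
  · simp [h]
  · have h0 : 0 < t := lt_of_le_of_ne (ha.spectrum_nonneg ht) (Ne.symm h)
    have : t⁻¹ ≤ max C 0 := (hC ⟨t, ht, rfl⟩).trans (le_max_left _ _)
    simp only [h, if_false, sub_nonneg]
    calc (1 : ℝ) = t⁻¹ * t := (inv_mul_cancel₀ h).symm
      _ ≤ _ := by gcongr

/-- A positive element is dominated by its support. -/
theorem exists_pos_smul_supp_sub {a : A} (ha : Pos a) :
    ∃ C : ℝ, 0 ≤ C ∧ Pos ((C : ℂ) • supp a - a) := by
  have : FiniteDimensional ℝ A := FiniteDimensional.trans ℝ ℂ A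
  obtain ⟨C, hC⟩ := (finite_spectrum_of_finiteDimensional a).bddAbove
  refine ⟨max C 0, le_max_right _ _, ?_⟩
  have e : ((max C 0 : ℝ) : ℂ) • supp a - a =
      cfc (fun t : ℝ => max C 0 * (if t = 0 then 0 else 1) - t) a := by
    rw [cfc_sub _ _ a (continuousOn_spectrum _ a) (continuousOn_spectrum _ a),
      cfc_const_mul _ _ a (continuousOn_spectrum _ a), cfc_id' ℝ a ha.isSelfAdjoint,
      Complex.coe_smul]; rfl
  rw [e]
  refine pos_cfc _ fun t ht => ?_
  by_cases h : t = 0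
  · simp [h]
  · simpa [h] using Or.inl (hC ht)

/-- A positive functional that is faithful controls the norm of positive elements. -/
theorem exists_norm_le_of_faithful (φ : A →ₗ[ℂ] ℂ)
    (hφ : ∀ a, Pos a → a ≠ 0 → 0 < (φ a).re) :
    ∃ C : ℝ, 0 ≤ C ∧ ∀ a, Pos a → ‖a‖ ≤ C * (φ a).re := by
  have : ProperSpace A := FiniteDimensional.proper ℂ A
  have hcont : Continuous fun a => (φ a).re :=
    Complex.continuous_re.comp φ.continuous_of_finiteDimensional
  set K : Set A := {a | Pos a} ∩ Metric.sphere 0 1 with hK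
  have hKc : IsCompact K := (isCompact_sphere _ _).inter_left isClosed_pos
  -- By compactness the functional has a positive minimum on the positive elements of norm one; its
  -- inverse is the constant sought.
  have hres : ∃ δ : ℝ, 0 < δ ∧ ∀ a ∈ K, δ ≤ (φ a).re := by
    rcases K.eq_empty_or_nonempty with h | h
    · exact ⟨1, one_pos, by simp [h]⟩
    · obtain ⟨a, ha, hmin⟩ := hKc.exists_isMinOn h hcont.continuousOn
      refine ⟨_, hφ a ha.1 ?_, fun b hb => hmin hb⟩
      rintro rfl
      simpa using ha.2
  obtain ⟨δ, hδ, hmin⟩ := hres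
  refine ⟨δ⁻¹, inv_nonneg.2 hδ.le, fun a ha => ?_⟩
  by_cases h0 : a = 0
  · simp [h0]
  have hn : 0 < ‖a‖ := norm_pos_iff.2 h0
  have hb : ((‖a‖⁻¹ : ℝ) : ℂ) • a ∈ K := by
    refine ⟨ha.smul (inv_nonneg.2 hn.le), ?_⟩
    rw [mem_sphere_zero_iff_norm, norm_smul, Complex.norm_real, norm_inv, norm_norm,
      inv_mul_cancel₀ hn.ne']
  have := hmin _ hb
  rw [map_smul, smul_eq_mul, Complex.re_ofReal_mul] at this
  rw [inv_mul_eq_div, le_div_iff₀ hδ]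
  calc ‖a‖ * δ ≤ ‖a‖ * (‖a‖⁻¹ * (φ a).re) := by gcongr
    _ = (φ a).re := by field_simp

end FiniteDimensional

end CStar

end CStarPlanarAlgebra

/-! ### Semisimplicity of a dominant eigenvalue and the Abel limit of the resolvent -/

section Ergodic

variable {A : Type*} [NormedRing A] [NormedAlgebra ℂ A]

/-- If `‖u ^ n‖ ≤ C r ^ n`, the eigenvalue `r` of left multiplication by `u` is semisimple. -/
theorem eq_zero_of_mul_eq_smul {u v b : A} {r C : ℝ} (hC : ∀ n, ‖u ^ n‖ ≤ C * r ^ n)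
    (hr : 0 ≤ r) (h : u * v = (r : ℂ) • v) (hb : v = (r : ℂ) • b - u * b) : v = 0 := by
  rcases hr.eq_or_lt with rfl | hr
  · have : u = 0 := by
      have := hC 1
      simp only [pow_one, mul_zero] at this
      exact norm_le_zero_iff.1 this
    rw [hb, this]; simp
  have key : ∀ n : ℕ, ((n * r ^ n : ℝ) : ℂ) • v =
      ((r ^ (n + 1) : ℝ) : ℂ) • b - (r : ℂ) • (u ^ n * b) := by
    intro n
    induction n with
    | zero => simp
    | succ n ih =>
      have e1 : u * (((n * r ^ n : ℝ) : ℂ) • v) = ((n * r ^ (n + 1) : ℝ) : ℂ) • v := by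
        rw [mul_smul_comm, h, smul_smul]; congr 1; push_cast; ring
      have e2 : u * (((r ^ (n + 1) : ℝ) : ℂ) • b - (r : ℂ) • (u ^ n * b)) =
          ((r ^ (n + 1) : ℝ) : ℂ) • (u * b) - (r : ℂ) • (u ^ (n + 1) * b) := by
        rw [mul_sub, mul_smul_comm, mul_smul_comm, ← mul_assoc, ← pow_succ']
      have e3 : u * b = (r : ℂ) • b - v := by rw [hb]; abel
      rw [ih] at e1
      rw [e2, e3, smul_sub, smul_smul] at e1
      have e4 : (((n + 1 : ℕ) * r ^ (n + 1) : ℝ) : ℂ) • v =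
          ((n * r ^ (n + 1) : ℝ) : ℂ) • v + ((r ^ (n + 1) : ℝ) : ℂ) • v := by
        rw [← add_smul]; congr 1; push_cast; ring
      rw [e4, ← e1]
      have e5 : ((r ^ (n + 1) : ℝ) : ℂ) * (r : ℂ) = ((r ^ (n + 1 + 1) : ℝ) : ℂ) := by
        push_cast; ring
      rw [e5]; abel
  by_contra hv
  have hv' : 0 < ‖v‖ := norm_pos_iff.2 hv
  have bound : ∀ n : ℕ, (n : ℝ) * ‖v‖ ≤ (1 + C) * r * ‖b‖ := by
    intro n
    have hrn : 0 < r ^ n := pow_pos hr n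
    have h1 := congrArg norm (key n)
    rw [norm_smul, Complex.norm_real, Real.norm_of_nonneg (by positivity)] at h1
    have h2 : ‖((r ^ (n + 1) : ℝ) : ℂ) • b - (r : ℂ) • (u ^ n * b)‖ ≤
        r ^ (n + 1) * ‖b‖ + r * (C * r ^ n * ‖b‖) := by
      refine (norm_sub_le _ _).trans ?_
      rw [norm_smul, norm_smul, Complex.norm_real, Complex.norm_real,
        Real.norm_of_nonneg (by positivity), Real.norm_of_nonneg hr.le]
      gcongr
      exact (norm_mul_le _ _).trans (by gcongr; exact hC n)
    have h3 : r ^ n * (n * ‖v‖) ≤ r ^ n * ((1 + C) * r * ‖b‖) := by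
      calc r ^ n * (n * ‖v‖) = n * r ^ n * ‖v‖ := by ring
        _ ≤ _ := h1.le.trans h2
        _ = _ := by ring
    exact le_of_mul_le_mul_left h3 hrn
  obtain ⟨n, hn⟩ := exists_nat_gt ((1 + C) * r * ‖b‖ / ‖v‖)
  rw [div_lt_iff₀ hv'] at hn
  linarith [bound n]

variable [FiniteDimensional ℂ A]

/-- The decomposition of `1` along the eigenspace of `u` for `r` and the range of `r - u`. -/
theorem exists_eigen_decomposition {u : A} {r C : ℝ} (hC : ∀ n, ‖u ^ n‖ ≤ C * r ^ n)
    (hr : 0 ≤ r) : ∃ e b : A, u * e = (r : ℂ) • e ∧ (1 : A) = e + ((r : ℂ) • b - u * b) := by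
  set L : A →ₗ[ℂ] A := (r : ℂ) • LinearMap.id - LinearMap.mulLeft ℂ u with hL
  have hLa : ∀ a, L a = (r : ℂ) • a - u * a := fun a => by simp [hL]
  have hdis : Disjoint (LinearMap.ker L) (LinearMap.range L) := by
    rw [Submodule.disjoint_def]
    rintro v hv ⟨b, hb⟩
    rw [LinearMap.mem_ker, hLa, sub_eq_zero] at hv
    exact eq_zero_of_mul_eq_smul hC hr hv.symm (by rw [← hb, hLa])
  have htop : LinearMap.ker L ⊔ LinearMap.range L = ⊤ := by
    apply Submodule.eq_top_of_disjoint _ _ _ hdis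
    rw [add_comm]
    exact (LinearMap.finrank_range_add_finrank_ker L).ge
  have h1 : (1 : A) ∈ LinearMap.ker L ⊔ LinearMap.range L := htop ▸ Submodule.mem_top
  obtain ⟨e, he, f, ⟨b, rfl⟩, h⟩ := Submodule.mem_sup.1 h1
  rw [LinearMap.mem_ker, hLa, sub_eq_zero] at he
  exact ⟨e, b, he.symm, by rw [← hLa, h]⟩

/-- The Neumann series and its Abel limit for an element with `‖u ^ n‖ ≤ C r ^ n`. -/
theorem exists_abel_limit {u : A} {r C : ℝ} (hC : ∀ n, ‖u ^ n‖ ≤ C * r ^ n) (hr : 0 ≤ r) :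
    ∃ (S : ℝ → A) (e : A),
      (∀ z : ℝ, r < z → HasSum (fun j : ℕ => ((z : ℂ) ^ (j + 1))⁻¹ • u ^ j) (S z)) ∧
      Tendsto (fun z : ℝ => ((z - r : ℝ) : ℂ) • S z) (𝓝[>] r) (𝓝 e) ∧ e * u = (r : ℂ) • e := by
  have : CompleteSpace A := FiniteDimensional.complete ℂ A
  obtain ⟨e, b, he, h1⟩ := exists_eigen_decomposition hC hr
  have hnorm : ∀ z : ℝ, r < z → ∀ j : ℕ,
      ‖((z : ℂ) ^ (j + 1))⁻¹ • u ^ j‖ ≤ C * z⁻¹ * (r / z) ^ j := by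
    intro z hz j
    have hz0 : 0 < z := hr.trans_lt hz
    rw [norm_smul, norm_inv, norm_pow, Complex.norm_real, Real.norm_of_nonneg hz0.le]
    calc (z ^ (j + 1))⁻¹ * ‖u ^ j‖ ≤ (z ^ (j + 1))⁻¹ * (C * r ^ j) := by gcongr; exact hC j
      _ = _ := by rw [pow_succ, div_pow]; field_simp
  have hgeo : ∀ z : ℝ, r < z → HasSum (fun j : ℕ => C * z⁻¹ * (r / z) ^ j) (C * (z - r)⁻¹) := by
    intro z hz
    have hz0 : 0 < z := hr.trans_lt hz
    have h := (hasSum_geometric_of_lt_one (div_nonneg hr hz0.le)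
      ((div_lt_one hz0).2 hz)).mul_left (C * z⁻¹)
    have h0 : z - r ≠ 0 := by linarith
    have e : C * z⁻¹ * (1 - r / z)⁻¹ = C * (z - r)⁻¹ := by
      have e : 1 - r / z = (z - r) / z := by field_simp
      rw [e]
      field_simp
    rwa [e] at h
  have hsum : ∀ z : ℝ, r < z → Summable (fun j : ℕ => ((z : ℂ) ^ (j + 1))⁻¹ • u ^ j) :=
    fun z hz => Summable.of_norm_bounded (hgeo z hz).summable (hnorm z hz)
  set S : ℝ → A := fun z => ∑' j : ℕ, ((z : ℂ) ^ (j + 1))⁻¹ • u ^ j with hS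
  have hSn : ∀ z : ℝ, r < z → ‖S z‖ ≤ C * (z - r)⁻¹ := fun z hz =>
    tsum_of_norm_bounded (hgeo z hz) (hnorm z hz)
  have hSu : ∀ z : ℝ, r < z → S z * u = (z : ℂ) • S z - 1 := by
    intro z hz
    have hz0 : (z : ℂ) ≠ 0 := by exact_mod_cast (hr.trans_lt hz).ne'
    have k1 := (hsum z hz).hasSum.mul_right u
    have k2 := (hsum z hz).hasSum.const_smul (z : ℂ)
    rw [← hasSum_nat_add_iff' 1] at k2
    simp only [Finset.sum_range_one, zero_add, pow_zero, pow_one, smul_smul,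
      mul_inv_cancel₀ hz0, one_smul] at k2
    refine k1.unique (k2.congr_fun ?_)
    intro j
    simp only [smul_mul_assoc, ← pow_succ]
    congr 1
    rw [pow_succ (z : ℂ) (j + 1)]
    field_simp
  have hlim : Tendsto (fun z : ℝ => ((z - r : ℝ) : ℂ) • S z) (𝓝[>] r) (𝓝 e) := by
    rw [tendsto_iff_norm_sub_tendsto_zero]
    have hzero : Tendsto (fun z : ℝ => (z - r) * ((1 + C) * ‖b‖)) (𝓝[>] r) (𝓝 0) := by
      have : Tendsto (fun z : ℝ => (z - r) * ((1 + C) * ‖b‖)) (𝓝 r)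
          (𝓝 ((r - r) * ((1 + C) * ‖b‖))) := by
        apply Continuous.tendsto; fun_prop
      rw [sub_self, zero_mul] at this
      exact this.mono_left nhdsWithin_le_nhds
    refine squeeze_zero' (Eventually.of_forall fun z => norm_nonneg _) ?_ hzero
    filter_upwards [self_mem_nhdsWithin] with z hz
    have hz : r < z := hz
    have hpos : 0 < z - r := sub_pos.2 hz
    have e1 : ((z - r : ℝ) : ℂ) • (S z * e) = e := by
      have h := congrArg (· * e) (hSu z hz)
      simp only [sub_mul, one_mul, smul_mul_assoc, mul_assoc, he, mul_smul_comm] at h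
      rw [Complex.ofReal_sub, sub_smul, h]
      abel
    have e2 : S z * ((r : ℂ) • b - u * b) = b - ((z - r : ℝ) : ℂ) • (S z * b) := by
      rw [mul_sub, ← mul_assoc, hSu z hz, sub_mul, one_mul, smul_mul_assoc, mul_smul_comm,
        Complex.ofReal_sub, sub_smul]
      abel
    -- Applied to `1 = e + (r - u) b`, the scaled resolvent fixes `e` and sends the other part to `z
    -- - r` times an element of norm at most `(1 + C) ‖b‖`.
    have e3 : ((z - r : ℝ) : ℂ) • S z - e =
        ((z - r : ℝ) : ℂ) • (b - ((z - r : ℝ) : ℂ) • (S z * b)) := by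
      rw [← e2]
      nth_rw 1 [← mul_one (S z), h1]
      rw [mul_add, smul_add, e1]
      abel
    rw [e3, norm_smul, Complex.norm_real, Real.norm_of_nonneg hpos.le]
    gcongr
    refine (norm_sub_le _ _).trans ?_
    rw [norm_smul, Complex.norm_real, Real.norm_of_nonneg hpos.le, add_mul, one_mul]
    refine add_le_add le_rfl ?_
    calc (z - r) * ‖S z * b‖ ≤ (z - r) * (C * (z - r)⁻¹ * ‖b‖) := by
          gcongr
          exact (norm_mul_le _ _).trans (by gcongr; exact hSn z hz)
      _ = C * ‖b‖ := by field_simp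
  refine ⟨S, e, fun z hz => (hsum z hz).hasSum, hlim, ?_⟩
  -- The decomposition only gave `u e = r e`; the relation with `u` on the right comes from the
  -- limit of `S u = z S - 1`.
  have k1 : Tendsto (fun z : ℝ => (((z - r : ℝ) : ℂ) • S z) * u) (𝓝[>] r) (𝓝 (e * u)) :=
    hlim.mul_const u
  have k2 : Tendsto (fun z : ℝ => (z : ℂ) • (((z - r : ℝ) : ℂ) • S z) - ((z - r : ℝ) : ℂ) • (1 : A))
      (𝓝[>] r) (𝓝 ((r : ℂ) • e - ((r - r : ℝ) : ℂ) • (1 : A))) := by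
    have c1 : Tendsto (fun z : ℝ => (z : ℂ)) (𝓝[>] r) (𝓝 (r : ℂ)) :=
      (Complex.continuous_ofReal.tendsto r).mono_left nhdsWithin_le_nhds
    have c2 : Tendsto (fun z : ℝ => ((z - r : ℝ) : ℂ) • (1 : A)) (𝓝[>] r)
        (𝓝 (((r - r : ℝ) : ℂ) • (1 : A))) := by
      refine Tendsto.mono_left (Continuous.tendsto ?_ r) nhdsWithin_le_nhds
      fun_prop
    exact (c1.smul hlim).sub c2
  rw [sub_self, Complex.ofReal_zero, zero_smul, sub_zero] at k2
  refine tendsto_nhds_unique k1 (k2.congr' ?_)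
  filter_upwards [self_mem_nhdsWithin] with z hz
  rw [smul_mul_assoc, hSu z hz, smul_sub, smul_comm]

end Ergodic

/-! ### The diagram identities as statements about the C⋆-algebras `P.Box` -/

namespace CStarPlanarAlgebra

variable {P : CStarPlanarAlgebra.{u}}

/-! ### Rotation of `1`-boxes -/

theorem barHom_comp {s t : Bool} (h : shade t 1 = s) (a b : P.Hom s 1 1) :
    barHom h (P.comp a b) = P.comp (barHom h b) (barHom h a) := by
  obtain rfl : s = !t := by rw [← h, shade_one]
  have h' : shade (!t) 1 = t := shade_not_one t
  have e : barHom h' (P.comp (barHom h b) (barHom h a)) = P.comp a b := by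
    apply cap_injective
    rw [← P.comp_one (P.cap (!t)), ← P.ap_zero_zero (P.cap (!t)) _ (shade_zero _)
      (shade_two_eq _).symm rfl rfl, ← cap_bar 1 1 h, barHom_barHom, P.ap_comp 2, P.ap_comp 2,
      cap_bar 1 1, P.ap_exch' 0 1 1 2 a, cap_bar 1 1]
    all_goals first | rfl | exact shade_not_one t
  rw [← e, barHom_barHom]

theorem bar_mul {s t : Bool} (h : shade t 1 = s) (a b : P.Box s 1) :
    P.bar h (a * b) = P.bar h b * P.bar h a := barHom_comp h a b

theorem bar_bar {s t : Bool} (h : shade t 1 = s) (h' : shade s 1 = t) (y : P.Box s 1) :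
    P.bar h' (P.bar h y) = y := barHom_barHom h h' y

theorem barHom_adj {s t : Bool} (h : shade t 1 = s) (a : P.Hom s 1 1) :
    barHom h (P.adj a) = P.adj (barHom h a) := by
  obtain rfl : s = !t := by rw [← h, shade_one]
  have h' : shade (!t) 1 = t := shade_not_one t
  have e : barHom h' (P.adj (barHom h a)) = P.adj a := by
    apply cup_injective
    have k := cap_bar 1 1 h a (P.one (!t) 0) (shade_zero (!t)) (shade_not_one t) rfl rfl rfl rfl
    have k2 := congrArg P.adj k
    rw [P.ap_zero_zero (P.cap _), P.comp_one, PlanarCalculus.ap, PlanarCalculus.ap, P.adj_comp,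
      P.adj_comp, adj_layer, adj_layer, adj_cap] at k2
    rw [cup_bar_left 1 1, P.ap_zero_zero, P.ap_zero_zero, PlanarCalculus.ap, PlanarCalculus.ap,
      P.comp_one, P.comp_one, k2]
    all_goals first | rfl | exact shade_not_one t
  rw [← e, barHom_barHom]

theorem bar_star {s t : Bool} (h : shade t 1 = s) (a : P.Box s 1) :
    P.bar h (star a) = star (P.bar h a) := barHom_adj h a

/-! ### Juxtaposition -/

theorem juxt_mul {s : Bool} (a a' : P.Box s 1) (b b' : P.Box (!s) 1) :
    P.juxt a b * P.juxt a' b' = P.juxt (a * a') (b * b') :=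
  (P.tens_comp (s := s) (m := 1) (m' := 1) (shade_one s) (shade_one s) (shade_one s) a a' b
    b').symm

theorem juxt_one_one {s : Bool} : P.juxt (1 : P.Box s 1) 1 = 1 :=
  P.one_tens_one (m := 1) (m' := 1) (shade_one s)

theorem juxt_sub_left {s : Bool} (a a' : P.Box s 1) (b : P.Box (!s) 1) :
    P.juxt (a - a') b = P.juxt a b - P.juxt a' b :=
  LinearMap.map_sub₂ (P.tens (s := s) (shade_one s) (shade_one s)) a a' b

theorem juxt_sub_right {s : Bool} (a : P.Box s 1) (b b' : P.Box (!s) 1) :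
    P.juxt a (b - b') = P.juxt a b - P.juxt a b' :=
  map_sub (P.tens (s := s) (shade_one s) (shade_one s) a) b b'

/-! ### The Fourier transform -/

theorem fourierHom_add {s : Bool} (x y : P.Hom s 2 2) :
    fourierHom (x + y) = fourierHom x + fourierHom y := by
  simp only [fourierHom, fourier, map_add, LinearMap.add_apply]

theorem fourierHom_smul {s : Bool} (c : ℂ) (x : P.Hom s 2 2) :
    fourierHom (c • x) = c • fourierHom x := by
  simp only [fourierHom, fourier, map_smul, LinearMap.smul_apply]

theorem convLHom_add {s : Bool} (y y' : P.Hom s 1 1) (w : P.Hom (!s) 2 2) :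
    convLHom (y + y') w = convLHom y w + convLHom y' w := by
  simp only [convLHom, convL, map_add, LinearMap.add_apply]

theorem convLHom_smul {s : Bool} (c : ℂ) (y : P.Hom s 1 1) (w : P.Hom (!s) 2 2) :
    convLHom (c • y) w = c • convLHom y w := by
  simp only [convLHom, convL, map_smul, LinearMap.smul_apply]

theorem convLHom_add_right {s : Bool} (y : P.Hom s 1 1) (w w' : P.Hom (!s) 2 2) :
    convLHom y (w + w') = convLHom y w + convLHom y w' := by
  simp only [convLHom, convL, map_add, LinearMap.add_apply]

theorem convLHom_smul_right {s : Bool} (c : ℂ) (y : P.Hom s 1 1) (w : P.Hom (!s) 2 2) :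
    convLHom y (c • w) = c • convLHom y w := by
  simp only [convLHom, convL, map_smul, LinearMap.smul_apply]

/-- The Fourier transform as a linear map. -/
def fourierL (P : CStarPlanarAlgebra.{u}) (s : Bool) : P.Box s 2 →ₗ[ℂ] P.Box (!s) 2 where
  toFun x := P.fourier x
  map_add' x y := fourierHom_add x y
  map_smul' c x := fourierHom_smul c x

theorem fourierL_injective (s : Bool) : Function.Injective (fourierL P s) :=
  fun _ _ h => fourierHom_injective h

/-- The convolution as a bilinear map. -/
def convLM (P : CStarPlanarAlgebra.{u}) (s : Bool) :
    P.Box (!s) 2 →ₗ[ℂ] P.Box s 1 →ₗ[ℂ] P.Box s 1 :=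
  LinearMap.mk₂ ℂ (fun w y => P.convL y w) (fun w w' y => convLHom_add_right y w w')
    (fun c w y => convLHom_smul_right c y w) (fun w y y' => convLHom_add y y' w)
    (fun c w y => convLHom_smul c y w)

/-- The action of a `2`-box `x` on `1`-boxes `y` by `y * x̂`. -/
def act {s : Bool} (x : P.Box s 2) : P.Box s 1 →ₗ[ℂ] P.Box s 1 := convLM P s (fourierL P s x)

theorem act_mul {s : Bool} (x x' : P.Box s 2) (y : P.Box s 1) :
    act (x * x') y = act x' (act x y) := convLHom_comp y x x'

theorem act_one {s : Bool} (y : P.Box s 1) : act (1 : P.Box s 2) y = y := convLHom_one y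

theorem act_juxt {s : Bool} (a b y : P.Box s 1) :
    act (P.juxt a (P.bar (shade_not_one s) b)) y = b * (y * a) := convLHom_tens y a b

theorem act_add {s : Bool} (x x' : P.Box s 2) (y : P.Box s 1) :
    act (x + x') y = act x y + act x' y := by
  simp only [act, map_add, LinearMap.add_apply]

theorem act_sub {s : Bool} (x x' : P.Box s 2) (y : P.Box s 1) :
    act (x - x') y = act x y - act x' y := by
  simp only [act, map_sub, LinearMap.sub_apply]

theorem act_smul {s : Bool} (c : ℂ) (x : P.Box s 2) (y : P.Box s 1) :
    act (c • x) y = c • act x y := by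
  simp only [act, map_smul, LinearMap.smul_apply]

/-- The `2`-box `1 ⊗ c`, with the middle region of the colour opposite to the left one. -/
def rt {s : Bool} (c : P.Box s 1) : P.Box (!s) 2 := idTens (s := s) c

/-- The `2`-box `c̄ ⊗ 1`. -/
def lt {s : Bool} (c : P.Box s 1) : P.Box (!s) 2 := barTens (s := s) c

theorem star_rt {s : Bool} (c : P.Box s 1) : star (rt c) = rt (star c) :=
  adj_layer (s := !s) (t := s) (a := 1) (b := 0) (M := 2) (N := 2) (m := 1) (n := 1) c
    (shade_not_one s) rfl rfl rfl

theorem adj_barTens {s : Bool} (c : P.Hom s 1 1) :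
    P.adj (barTens c) = barTens (P.adj c) := by
  unfold barTens
  rw [adj_layer, barHom_adj]

theorem star_lt {s : Bool} (c : P.Box s 1) : star (lt c) = lt (star c) :=
  adj_barTens (s := s) c

theorem fourier_mul_juxt_one {s : Bool} (x : P.Box s 2) (c : P.Box s 1) :
    P.fourier (x * P.juxt c 1) = P.fourier x * rt c := fourierHom_comp_tens_one x c

theorem fourier_juxt_one_mul {s : Bool} (x : P.Box s 2) (c : P.Box s 1) :
    P.fourier (P.juxt c 1 * x) = P.fourier x * lt c := fourierHom_tens_one_comp x c

theorem fourier_mul_one_juxt {s : Bool} (x : P.Box s 2) (c : P.Box s 1) :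
    P.fourier (x * P.juxt 1 (P.bar (shade_not_one s) c)) = rt c * P.fourier x :=
  fourierHom_comp_one_tens x c

theorem fourier_one_juxt_mul {s : Bool} (x : P.Box s 2) (c : P.Box s 1) :
    P.fourier (P.juxt 1 (P.bar (shade_not_one s) c) * x) = lt c * P.fourier x :=
  fourierHom_one_tens_comp x c

/-! ### Positivity -/

theorem closure_add {s : Bool} {n : ℕ} (f g : P.Hom s n n) :
    P.closure (f + g) = P.closure f + P.closure g := by
  induction n with
  | zero => rfl
  | succ n ih =>
    have h : P.closeLast (f + g) = P.closeLast f + P.closeLast g := by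
      simp only [PlanarCalculus.closeLast, map_add, LinearMap.add_apply]
    change P.closure (P.closeLast (f + g)) = P.closure (P.closeLast f) + P.closure (P.closeLast g)
    rw [h, ih]

theorem closure_smul {s : Bool} {n : ℕ} (c : ℂ) (f : P.Hom s n n) :
    P.closure (c • f) = c • P.closure f := by
  induction n with
  | zero => rfl
  | succ n ih =>
    have h : P.closeLast (c • f) = c • P.closeLast f := by
      simp only [PlanarCalculus.closeLast, map_smul, LinearMap.smul_apply]
    change P.closure (P.closeLast (c • f)) = c • P.closure (P.closeLast f)
    rw [h, ih]

/-- The trace on `P_{n,s}`. -/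
def tr (P : CStarPlanarAlgebra.{u}) (s : Bool) (n : ℕ) : P.Box s n →ₗ[ℂ] ℂ where
  toFun x := P.tr₀ s (P.closure x)
  map_add' x y := (congrArg (P.tr₀ s) (closure_add (P := P) (s := s) x y)).trans (map_add _ _ _)
  map_smul' c x :=
    (congrArg (P.tr₀ s) (closure_smul (P := P) (s := s) c x)).trans (map_smul _ _ _)

theorem re_tr_comp_adj_self_pos {s : Bool} {n : ℕ} {f : P.Hom s n n} (hf : f ≠ 0) :
    0 < (P.tr₀ s (P.closure (P.comp f (P.adj f)))).re := by
  have h := (P.tr_pos (P.adj f) fun h => hf (by rw [← P.adj_adj f, h, map_zero])).1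
  rwa [P.adj_adj] at h

theorem tr_mul_star_pos {s : Bool} {n : ℕ} {a : P.Box s n} (ha : a ≠ 0) :
    0 < (P.tr s n (a * star a)).re := re_tr_comp_adj_self_pos (s := s) (f := a) ha

theorem tr_pos_of_pos {s : Bool} {n : ℕ} {a : P.Box s n} (ha : Pos a) (h0 : a ≠ 0) :
    0 < (P.tr s n a).re := by
  obtain ⟨b, rfl⟩ := ha
  exact tr_mul_star_pos fun h => h0 (by rw [h, zero_mul])

theorem tr_re_nonneg {s : Bool} {n : ℕ} {a : P.Box s n} (ha : Pos a) :
    0 ≤ (P.tr s n a).re := by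
  by_cases h : a = 0
  · simp [h]
  · exact (tr_pos_of_pos ha h).le

theorem tr_mul_comm {s : Bool} (a b : P.Box s 1) : P.tr s 1 (a * b) = P.tr s 1 (b * a) :=
  congrArg (P.tr₀ s) (closure_comp_comm (s := s) a b)

theorem tr_act_mul_bar {s : Bool} (x : P.Box s 2) (y : P.Box s 1) (z : P.Box (!s) 1) :
    P.tr s 1 (act x y * P.bar (shade_one s) z) =
      P.tr s 1 (y * P.bar (shade_one s) (P.convR (P.fourier x) z)) :=
  congrArg (P.tr₀ s) (closure_convLHom (s := s) x y z)

/-- A box `V V⋆` is positive when `V` has two more strings at the top than at the bottom. -/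
theorem pos_comp_adj {t : Bool} {n : ℕ} (V : P.Hom t (n + 2) n) :
    Pos (A := P.Box t n) (P.comp V (P.adj V)) := by
  have e : ∀ u : P.Hom t n n, P.comp (P.comp u (P.comp V (P.adj V))) (P.adj u) =
      P.comp (P.comp u V) (P.adj (P.comp u V)) := by
    intro u
    rw [P.adj_comp, P.comp_assoc, P.comp_assoc, P.comp_assoc]
  have hsa : P.adj (P.comp V (P.adj V)) = P.comp V (P.adj V) := by rw [P.adj_comp, P.adj_adj]
  refine pos_of_functional hsa (P.tr t n) (fun u => ?_) fun a ha => tr_mul_star_pos ha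
  have key : ∀ u : P.Hom t n n,
      0 ≤ (P.tr₀ t (P.closure (P.comp (P.comp u (P.comp V (P.adj V))) (P.adj u)))).re := by
    intro u
    rw [e]
    by_cases h : P.comp u V = 0
    · rw [h, LinearMap.map_zero₂]
      exact (congrArg Complex.re (map_zero (P.tr t n))).ge
    · exact (re_tr_comp_adj_pos h).le
  exact key u

theorem eq_zero_of_comp_adj_eq_zero {t : Bool} {n : ℕ} {V : P.Hom t (n + 2) n}
    (h : P.comp V (P.adj V) = 0) : V = 0 := by
  by_contra hV
  have := re_tr_comp_adj_pos hV
  rw [h] at this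
  exact this.ne' (congrArg Complex.re (map_zero (P.tr t n)))

theorem pos_convL {s : Bool} {y : P.Box s 1} {w : P.Box (!s) 2} (hy : Pos y) (hw : Pos w) :
    Pos (P.convL y w) := by
  obtain ⟨a, rfl⟩ := hy
  obtain ⟨b, rfl⟩ := hw
  have e : P.convL (a * star a) (b * star b) = _ := convLHom_sq (s := s) a b
  rw [e]
  exact pos_comp_adj (convHalf (s := s) a b)

theorem pos_act {s : Bool} {x : P.Box s 2} (hx : FPositive x) {y : P.Box s 1} (hy : Pos y) :
    Pos (act x y) := pos_convL hy hx

/-- The closure of the left string is faithful. -/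
theorem eq_zero_of_convL_one {s : Bool} {w : P.Box (!s) 2} (hw : Pos w) (h : P.convL 1 w = 0) :
    w = 0 := by
  obtain ⟨b, rfl⟩ := hw
  have e := convLHom_sq (P := P) (s := s) (P.one s 1) b
  rw [adj_one, P.comp_one] at e
  have h2 : convHalf (s := s) (P.one s 1) b = 0 :=
    eq_zero_of_comp_adj_eq_zero (e.symm.trans h)
  have hb : b = 0 := convHalf_one_injective h2
  rw [hb, zero_mul]

/-- Closing the left string of a positive 2-box is faithful and the Fourier transform is injective.
This reduces the vanishing of an `𝔉`-positive 2-box to a computation with 1-boxes. -/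
theorem FPositive.eq_zero {s : Bool} {x : P.Box s 2} (hx : FPositive x) (h : act x 1 = 0) :
    x = 0 :=
  fourierL_injective s ((eq_zero_of_convL_one hx h).trans (map_zero (fourierL P s)).symm)

/-- An analogue of the Schur product theorem: the Fourier transform turns the product into the
coproduct, and the coproduct of `b b⋆` and `d d⋆` is again of the form `V V⋆`. -/
theorem FPositive.mul {s : Bool} {x x' : P.Box s 2} (hx : FPositive x) (hx' : FPositive x') :
    FPositive (x * x') := by
  obtain ⟨b, hb⟩ := hx
  obtain ⟨d, hd⟩ := hx'
  have e := fourierHom_comp (s := s) x x'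
  have eb : fourierHom (s := s) x = P.comp b (P.adj b) := hb
  have ed : fourierHom (s := s) x' = P.comp d (P.adj d) := hd
  rw [eb, ed] at e
  have e' : P.fourier (x * x') = _ := e.trans (coprod_sq (s := s) b d)
  rw [FPositive, e']
  exact pos_comp_adj (coprodHalf (s := s) b d)

theorem juxt_eq_left {s : Bool} (a : P.Box s 1) (b : P.Box (!s) 1) :
    P.juxt a b = P.juxt a 1 * P.juxt 1 b := by rw [juxt_mul, mul_one, one_mul]

theorem juxt_eq_right {s : Bool} (a : P.Box s 1) (b : P.Box (!s) 1) :
    P.juxt a b = P.juxt 1 b * P.juxt a 1 := by rw [juxt_mul, mul_one, one_mul]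

theorem fourier_juxt_mul {s : Bool} (x : P.Box s 2) (a b : P.Box s 1) :
    P.fourier (P.juxt a (P.bar (shade_not_one s) b) * x) = lt b * P.fourier x * lt a := by
  rw [juxt_eq_left, mul_assoc, fourier_juxt_one_mul, fourier_one_juxt_mul]

theorem fourier_mul_juxt {s : Bool} (x : P.Box s 2) (a b : P.Box s 1) :
    P.fourier (x * P.juxt a (P.bar (shade_not_one s) b)) = rt b * P.fourier x * rt a := by
  rw [juxt_eq_right, ← mul_assoc, fourier_mul_juxt_one, fourier_mul_one_juxt]

theorem FPositive.juxt_mul {s : Bool} {x : P.Box s 2} (hx : FPositive x) {a : P.Box s 1}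
    (ha : IsSelfAdjoint a) : FPositive (P.juxt a (P.bar (shade_not_one s) a) * x) := by
  have h : IsSelfAdjoint (lt a) := by rw [IsSelfAdjoint, star_lt, ha.star_eq]
  rw [FPositive, fourier_juxt_mul]
  exact Pos.conj_self hx h

theorem FPositive.mul_juxt {s : Bool} {x : P.Box s 2} (hx : FPositive x) {a : P.Box s 1}
    (ha : IsSelfAdjoint a) : FPositive (x * P.juxt a (P.bar (shade_not_one s) a)) := by
  have h : IsSelfAdjoint (rt a) := by rw [IsSelfAdjoint, star_rt, ha.star_eq]
  rw [FPositive, fourier_mul_juxt]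
  exact Pos.conj_self hx h

end CStarPlanarAlgebra

/-! ### Supports of eigenvectors and the growth of the cut-down -/

namespace CStarPlanarAlgebra

section CStar

variable {A : Type*} [CStarAlgebra A]

/-- From `0 ≤ a ≤ b` follows `0 ≤ c⋆ a c ≤ c⋆ b c = 0`. -/
theorem Pos.mul_eq_zero_of_sub {a b c : A} (ha : Pos a) (hba : Pos (b - a)) (h : b * c = 0) :
    a * c = 0 := by
  refine ha.mul_eq_zero (eq_zero_of_pos_of_pos_neg ?_ ?_)
  · simpa using ha.conj (star c)
  · have := hba.conj (star c)
    rwa [star_star, mul_assoc, sub_mul, h, zero_sub, mul_neg, ← mul_assoc] at this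

theorem Pos.mul_eq_zero_of_add {a b c : A} (ha : Pos a) (hb : Pos b) (h : (a + b) * c = 0) :
    a * c = 0 :=
  ha.mul_eq_zero_of_sub (b := a + b) (by rwa [add_sub_cancel_left]) h

variable [FiniteDimensional ℂ A]

theorem mul_supp {a : A} (ha : IsSelfAdjoint a) : a * supp a = a := by
  have h := congrArg star (supp_mul ha)
  rwa [star_mul, (isStarProjection_supp a).isSelfAdjoint.star_eq, ha.star_eq] at h

/-- The square root of a positive element and its inverse on the support. -/
theorem cfc_sqrt_facts {a : A} (ha : Pos a) :
    cfc (fun t : ℝ => √t) a * cfc (fun t : ℝ => √t) a = a ∧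
      cfc (fun t : ℝ => √t) a * cfc (fun t : ℝ => (√t)⁻¹) a = supp a ∧
      cfc (fun t : ℝ => (√t)⁻¹) a * cfc (fun t : ℝ => √t) a = supp a ∧
      supp a * cfc (fun t : ℝ => √t) a = cfc (fun t : ℝ => √t) a ∧
      cfc (fun t : ℝ => √t) a * supp a = cfc (fun t : ℝ => √t) a ∧
      supp a * cfc (fun t : ℝ => (√t)⁻¹) a = cfc (fun t : ℝ => (√t)⁻¹) a ∧
      cfc (fun t : ℝ => (√t)⁻¹) a * supp a = cfc (fun t : ℝ => (√t)⁻¹) a := by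
  have hne : ∀ t ∈ spectrum ℝ a, t ≠ 0 → √t ≠ 0 := fun t ht h0 =>
    Real.sqrt_ne_zero'.2 (lt_of_le_of_ne (ha.spectrum_nonneg ht) (Ne.symm h0))
  unfold supp
  simp only [cfc_mul_cfc]
  refine ⟨?_, ?_, ?_, ?_, ?_, ?_, ?_⟩
  · conv_rhs => rw [← cfc_id' ℝ a ha.isSelfAdjoint]
    exact cfc_congr fun t ht => Real.mul_self_sqrt (ha.spectrum_nonneg ht)
  all_goals
    refine cfc_congr fun t ht => ?_
    by_cases h : t = 0
    · simp [h]
    · simp [h, hne t ht h]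

/-- Positive elements that dominate each other up to scalars have the same support. -/
theorem supp_eq_supp {a b : A} (ha : Pos a) (hb : Pos b) {C D : ℝ}
    (hab : Pos ((C : ℂ) • b - a)) (hba : Pos ((D : ℂ) • a - b)) : supp a = supp b := by
  have key : ∀ {a b : A} {C : ℝ}, Pos a → Pos b → Pos ((C : ℂ) • b - a) →
      supp b * supp a = supp a := by
    intro a b C ha hb hab
    have h0 : ((C : ℂ) • b) * (1 - supp b) = 0 := by
      rw [smul_mul_assoc, mul_sub, mul_one, mul_supp hb.isSelfAdjoint, sub_self, smul_zero]
    have h1 := ha.mul_eq_zero_of_sub hab h0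
    rw [mul_sub, mul_one, sub_eq_zero] at h1
    have h2 := congrArg star h1
    rw [star_mul, (isStarProjection_supp b).isSelfAdjoint.star_eq, ha.isSelfAdjoint.star_eq] at h2
    exact (isRangeProj_supp ha.isSelfAdjoint).2.2 _ (isStarProjection_supp b) h2.symm
  have h1 := key ha hb hab
  have h2 := congrArg star (key hb ha hba)
  rw [star_mul, (isStarProjection_supp b).isSelfAdjoint.star_eq,
    (isStarProjection_supp a).isSelfAdjoint.star_eq] at h2
  rw [← h1, h2]

end CStar

variable {P : CStarPlanarAlgebra.{u}} {s : Bool}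

theorem bar_sub {t : Bool} (h : shade t 1 = s) (a b : P.Box s 1) :
    P.bar h (a - b) = P.bar h a - P.bar h b := by
  have e : ∀ a b : P.Hom s 1 1, barHom h (a - b) = barHom h a - barHom h b := by
    intro a b
    simp only [barHom, bar, map_sub, LinearMap.sub_apply]
  exact e a b

theorem bar_smul {t : Bool} (h : shade t 1 = s) (c : ℂ) (a : P.Box s 1) :
    P.bar h (c • a) = c • P.bar h a := by
  have e : ∀ a : P.Hom s 1 1, barHom h (c • a) = c • barHom h a := by
    intro a
    simp only [barHom, bar, map_smul, LinearMap.smul_apply]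
  exact e a

theorem bar_one {t : Bool} (h : shade t 1 = s) : P.bar h (1 : P.Box s 1) = 1 := by
  obtain rfl : s = !t := by rw [← h, shade_one]
  have e := bar_mul h (P.bar (shade_not_one t) (1 : P.Box t 1)) 1
  rwa [mul_one, bar_bar, mul_one, eq_comm] at e

theorem Pos.bar {t : Bool} (h : shade t 1 = s) {a : P.Box s 1} (ha : Pos a) :
    Pos (P.bar h a) := by
  obtain ⟨b, rfl⟩ := ha
  rw [bar_mul, bar_star]
  exact ⟨star (P.bar h b), by rw [star_star]⟩

/-- The box `a ⊗ ā`. -/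
def dbl (a : P.Box s 1) : P.Box s 2 := P.juxt a (P.bar (shade_not_one s) a)

theorem dbl_mul_dbl {a b : P.Box s 1} (h : a * b = b * a) : dbl a * dbl b = dbl (a * b) := by
  rw [dbl, dbl, juxt_mul, ← bar_mul, ← h]; rfl

theorem act_dbl (a y : P.Box s 1) : act (dbl a) y = a * (y * a) := act_juxt a a y

theorem act_juxt_one (a y : P.Box s 1) : act (P.juxt a 1) y = y * a := by
  rw [← bar_one (shade_not_one s), act_juxt, one_mul]

theorem act_one_juxt (b y : P.Box s 1) :
    act (P.juxt 1 (P.bar (shade_not_one s) b)) y = b * y := by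
  rw [act_juxt, mul_one]

theorem specRad_nonneg (x : P.Box s 2) : 0 ≤ specRad x := ENNReal.toReal_nonneg

theorem mem_PFCone {x : P.Box s 2} {y : P.Box s 1} :
    y ∈ PFCone x ↔ act x y = (specRad x : ℂ) • y ∧ Pos y := Iff.rfl

theorem add_mem_PFCone {x : P.Box s 2} {y y' : P.Box s 1} (hy : y ∈ PFCone x)
    (hy' : y' ∈ PFCone x) : y + y' ∈ PFCone x := by
  rw [mem_PFCone] at *
  exact ⟨by rw [map_add, hy.1, hy'.1, smul_add], hy.2.add hy'.2⟩

/-- There is an eigenvector of maximal support. -/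
theorem exists_isPMax (x : P.Box s 2) : ∃ y ∈ PFCone x, IsPMax x (supp y) := by
  -- `K y` is the right annihilator of `y`, which shrinks as the support grows; a `y` with `K y` of
  -- least dimension has maximal support. The cone contains `0`, so such a `y` exists.
  set K : P.Box s 1 → Submodule ℂ (P.Box s 1) := fun y => LinearMap.ker (LinearMap.mulLeft ℂ y)
    with hK
  have hKm : ∀ y a, a ∈ K y ↔ y * a = 0 := fun y a => by simp [hK]
  set T : Set ℕ := {n | ∃ y ∈ PFCone x, Module.finrank ℂ (K y) = n} with hT
  have hne : T.Nonempty := ⟨_, 0, mem_PFCone.2 ⟨by simp, pos_zero⟩, rfl⟩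
  obtain ⟨y, hy, hmin⟩ := Nat.sInf_mem hne
  refine ⟨y, hy, ⟨y, hy, isRangeProj_supp hy.2.isSelfAdjoint⟩, ?_⟩
  rintro q ⟨y', hy', hq⟩
  have hle : K (y + y') ≤ K y := fun a ha => by
    rw [hKm] at *
    exact hy.2.mul_eq_zero_of_add hy'.2 ha
  have heq : K (y + y') = K y := by
    refine Submodule.eq_of_le_of_finrank_le hle ?_
    rw [hmin]
    exact Nat.sInf_le ⟨_, add_mem_PFCone hy hy', rfl⟩
  have h1 : 1 - supp y ∈ K (y + y') := by
    rw [heq, hKm, mul_sub, mul_one, mul_supp hy.2.isSelfAdjoint, sub_self]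
  rw [hKm, add_comm] at h1
  have h2 := hy'.2.mul_eq_zero_of_add hy.2 h1
  rw [mul_sub, mul_one, sub_eq_zero] at h2
  have h3 := congrArg star h2
  rw [star_mul, (isStarProjection_supp y).isSelfAdjoint.star_eq, hy'.2.isSelfAdjoint.star_eq] at h3
  exact hq.2.2 _ (isStarProjection_supp y) h3.symm

section Eigenvector

variable {x : P.Box s 2} {y : P.Box s 1}

/-- The support of an eigenvector is invariant. -/
theorem dbl_supp_mul (hx : FPositive x) (hy : y ∈ PFCone x) : dbl (supp y) * x = cutDown x (supp y)
    := by
  set p := supp y with hp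
  have hpp := isStarProjection_supp y
  have hps : star p = p := hpp.isSelfAdjoint.star_eq
  have hp' : IsSelfAdjoint (1 - p) := (IsSelfAdjoint.one _).sub hpp.isSelfAdjoint
  obtain ⟨C, hC, hCy⟩ := exists_pos_smul_sub_supp hy.2
  -- From `p ≤ C y` follows `act x p ≤ C r y`, so `act x p` is supported under `p`.
  have h1 : Pos (((C * specRad x : ℝ) : ℂ) • y - act x p) := by
    have := pos_act hx hCy
    rwa [map_sub, map_smul, (mem_PFCone.1 hy).1, smul_smul, ← Complex.ofReal_mul] at this
  have hpos : Pos p := ⟨p, by rw [hps]; exact hpp.isIdempotentElem.eq.symm⟩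
  have h2 : act x p * (1 - p) = 0 := by
    refine (pos_act hx hpos).mul_eq_zero_of_sub h1 ?_
    rw [smul_mul_assoc, mul_sub, mul_one, mul_supp hy.2.isSelfAdjoint, sub_self, smul_zero]
  have hw : FPositive (dbl p * x) := hx.juxt_mul hpp.isSelfAdjoint
  have h3 : dbl p * x * dbl (1 - p) = 0 := by
    refine (hw.mul_juxt hp').eq_zero ?_
    change act (P := P) (s := s) (dbl p * x * dbl (1 - p)) 1 = 0
    rw [act_mul, act_mul, act_dbl, act_dbl, one_mul, hpp.isIdempotentElem.eq, h2, mul_zero]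
  -- The positive element `w = 𝔉((p ⊗ p̄) x)` has zero compression by `1 ⊗ (1 - p)`, hence is
  -- annihilated by it on either side. Read back through the Fourier transform, each side removes
  -- the defect on one of the two upper legs of `(p ⊗ p̄) x`.
  have h4 : P.fourier (dbl p * x) * rt (1 - p) = 0 := by
    refine Pos.mul_eq_zero hw ?_
    rw [star_rt, hp'.star_eq, ← fourier_mul_juxt]
    exact (congrArg P.fourier h3).trans (map_zero (fourierL P s))
  have h5 : rt (1 - p) * P.fourier (dbl p * x) = 0 := by
    have := congrArg star h4
    rwa [star_mul, star_rt, hp'.star_eq, star_zero, (Pos.isSelfAdjoint hw).star_eq] at this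
  have h6 : dbl p * x * P.juxt (1 - p) 1 = 0 := by
    apply fourierL_injective s
    rw [map_zero]
    exact (fourier_mul_juxt_one _ _).trans h4
  have h7 : dbl p * x * P.juxt 1 (P.bar (shade_not_one s) (1 - p)) = 0 := by
    apply fourierL_injective s
    rw [map_zero]
    exact (fourier_mul_one_juxt _ _).trans h5
  rw [juxt_sub_left, juxt_one_one, mul_sub, mul_one, sub_eq_zero] at h6
  rw [bar_sub, juxt_sub_right, bar_one, juxt_one_one, mul_sub, mul_one, sub_eq_zero] at h7
  have h8 : cutDown x p = dbl p * x * (P.juxt p 1 * P.juxt 1 (P.bar (shade_not_one s) p)) := by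
    rw [← juxt_eq_left]; rfl
  rw [h8, ← mul_assoc, ← h6, ← h7]

theorem act_cutDown_supp (hx : FPositive x) (hy : y ∈ PFCone x) (z : P.Box s 1) :
    act (cutDown x (supp y)) z = act x (supp y * (z * supp y)) := by
  rw [← dbl_supp_mul hx hy, act_mul, act_dbl]

theorem supp_mul_act (hx : FPositive x) (hy : y ∈ PFCone x) (z : P.Box s 1) :
    supp y * (act x (supp y * (z * supp y)) * supp y) = act x (supp y * (z * supp y)) :=
  calc
    _ = act (dbl (supp y) * x * dbl (supp y)) z := by rw [act_mul, act_mul, act_dbl, act_dbl]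
    _ = _ := act_cutDown_supp hx hy z

theorem supp_conj_self (hy : y ∈ PFCone x) : supp y * (y * supp y) = y := by
  rw [mul_supp hy.2.isSelfAdjoint, supp_mul hy.2.isSelfAdjoint]

theorem fPositive_cutDown (hx : FPositive x) (hy : y ∈ PFCone x) : FPositive (cutDown x (supp y)) := by
  rw [← dbl_supp_mul hx hy]
  exact hx.juxt_mul (isStarProjection_supp y).isSelfAdjoint

theorem act_cutDown_pow (hx : FPositive x) (hy : y ∈ PFCone x) (n : ℕ) :
    act (cutDown x (supp y) ^ n) y = ((specRad x : ℂ) ^ n) • y := by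
  induction n with
  | zero => rw [pow_zero, pow_zero, one_smul, act_one]
  | succ n ih =>
    rw [pow_succ, act_mul, ih, map_smul, act_cutDown_supp hx hy, supp_conj_self hy,
      (mem_PFCone.1 hy).1, smul_smul, ← pow_succ]

theorem fPositive_cutDown_pow (hx : FPositive x) (hy : y ∈ PFCone x) (n : ℕ) : FPositive
    (cutDown x (supp y) ^ (n + 1)) := by
  induction n with
  | zero => rw [zero_add, pow_one]; exact fPositive_cutDown hx hy
  | succ n ih => rw [pow_succ]; exact ih.mul (fPositive_cutDown hx hy)

/-- The powers of the cut-down are bounded by the powers of the spectral radius of `x`. -/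
theorem exists_norm_cutDown_pow_le (hx : FPositive x) (hy : y ∈ PFCone x) :
    ∃ C : ℝ, ∀ n : ℕ, ‖cutDown x (supp y) ^ n‖ ≤ C * specRad x ^ n := by
  set p := supp y with hp
  set X := cutDown x p with hX
  set r := specRad x with hr
  -- The functional `w ↦ tr(1 * w)` is faithful on positive 2-boxes, so it controls the norm of the
  -- Fourier transform of each power of `X`.
  obtain ⟨C₁, hC₁, h1⟩ := exists_norm_le_of_faithful ((P.tr s 1) ∘ₗ ((convLM P s).flip 1))
    (fun w hw h0 => tr_pos_of_pos
      (pos_convL ⟨1, by rw [star_one, mul_one]⟩ hw) fun h => h0 (eq_zero_of_convL_one hw h))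
  obtain ⟨C₂, -, h2⟩ := LinearMap.exists_antilipschitzWith (fourierL P s)
    (LinearMap.ker_eq_bot.2 (fourierL_injective s))
  obtain ⟨C₃, hC₃, h3⟩ := exists_pos_smul_sub_supp hy.2
  have hJ : dbl p * X = X := by
    have hpp : p * p = p := (isStarProjection_supp y).isIdempotentElem.eq
    rw [hX, ← dbl_supp_mul hx hy, ← mul_assoc, dbl_mul_dbl rfl, hpp]
  -- The summand `‖1‖` serves the exponent `0`, for which `X ^ 0 = 1` lies outside the estimate for
  -- positive powers.
  refine ⟨C₂ * (C₁ * (C₃ * (P.tr s 1 y).re)) + ‖(1 : P.Box s 2)‖, fun n => ?_⟩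
  have hnn : 0 ≤ C₂ * (C₁ * (C₃ * (P.tr s 1 y).re)) := by
    have := tr_re_nonneg hy.2
    positivity
  have hr0 : 0 ≤ r := specRad_nonneg x
  rcases n with _ | n
  · rw [pow_zero, pow_zero, mul_one]
    linarith
  -- Since `(p ⊗ p̄) X = X`, the vector `1` may be replaced by `p`, and `p ≤ C₃ y` brings in the
  -- eigenvector.
  have e1 : act (X ^ (n + 1)) 1 = act (X ^ (n + 1)) p := by
    have hpp : p * p = p := (isStarProjection_supp y).isIdempotentElem.eq
    have e0 : dbl p * X ^ (n + 1) = X ^ (n + 1) := by rw [pow_succ', ← mul_assoc, hJ]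
    conv_lhs => rw [← e0]
    rw [act_mul, act_dbl, one_mul, hpp]
  have e2 : (P.tr s 1 (act (X ^ (n + 1)) 1)).re ≤ C₃ * r ^ (n + 1) * (P.tr s 1 y).re := by
    have := tr_re_nonneg (pos_act (fPositive_cutDown_pow hx hy n) h3)
    rw [map_sub, map_smul, act_cutDown_pow hx hy, smul_smul, map_sub, map_smul, smul_eq_mul,
      ← Complex.ofReal_pow, ← Complex.ofReal_mul, Complex.sub_re, Complex.re_ofReal_mul] at this
    rw [e1]
    linarith
  have e3 := h1 _ (fPositive_cutDown_pow hx hy n)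
  have e4 : ‖X ^ (n + 1)‖ ≤ C₂ * ‖P.fourier (X ^ (n + 1))‖ := by
    have := h2.le_mul_dist (X ^ (n + 1)) 0
    rwa [map_zero, dist_zero_right, dist_zero_right] at this
  have e5 : ‖P.fourier (X ^ (n + 1))‖ ≤ C₁ * (C₃ * r ^ (n + 1) * (P.tr s 1 y).re) :=
    e3.trans (mul_le_mul_of_nonneg_left e2 hC₁)
  calc ‖X ^ (n + 1)‖ ≤ C₂ * (C₁ * (C₃ * r ^ (n + 1) * (P.tr s 1 y).re)) :=
        e4.trans (mul_le_mul_of_nonneg_left e5 C₂.coe_nonneg)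
    _ = C₂ * (C₁ * (C₃ * (P.tr s 1 y).re)) * r ^ (n + 1) := by ring
    _ ≤ _ := by gcongr; linarith [norm_nonneg (1 : P.Box s 2)]

end Eigenvector

end CStarPlanarAlgebra

namespace CStarPlanarAlgebra

variable {P : CStarPlanarAlgebra.{u}} {s : Bool}

/-! ### The eigenvector of maximal support -/

section MaxSupportVector

theorem hasSum_resolvent_scalar {r z : ℝ} (hr : 0 ≤ r) (hz : r < z) :
    HasSum (fun j : ℕ => ((z : ℂ) ^ (j + 1))⁻¹ * (r : ℂ) ^ j) ((z - r : ℝ) : ℂ)⁻¹ := by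
  have hz0 : 0 < z := hr.trans_lt hz
  have hlt : r / z < 1 := (div_lt_one hz0).2 hz
  have h := (hasSum_geometric_of_lt_one (div_nonneg hr hz0.le) hlt).mul_left z⁻¹
  have h' : HasSum (fun j : ℕ => (z ^ (j + 1))⁻¹ * r ^ j) (z - r)⁻¹ := by
    have e1 : (z - r)⁻¹ = z⁻¹ * (1 - r / z)⁻¹ := by
      rw [← mul_inv, mul_sub, mul_one, mul_div_cancel₀ _ hz0.ne']
    have e2 : (fun j : ℕ => (z ^ (j + 1))⁻¹ * r ^ j) = fun j => z⁻¹ * (r / z) ^ j := by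
      funext j
      rw [div_pow, pow_succ]
      field_simp
    rw [e1, e2]
    exact h
  have := Complex.hasSum_ofReal.2 h'
  push_cast at this ⊢
  exact this

/-- The action on `w`, as a continuous linear map in the `2`-box. -/
def actCLM (w : P.Box s 1) : P.Box s 2 →L[ℂ] P.Box s 1 :=
  LinearMap.toContinuousLinearMap ((convLM P s).flip w ∘ₗ fourierL P s)

theorem actCLM_apply (w : P.Box s 1) (x : P.Box s 2) : actCLM w x = act x w := rfl

variable {x : P.Box s 2} {y : P.Box s 1}

/-- The series and the limit defining the eigenvector of maximal support exist, and the limit is a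
positive eigenvector with the same support as `y`. -/
theorem exists_maxSupportVector (hx : FPositive x) (hy : y ∈ PFCone x) :
    ∃ ζ ∈ PFCone x, IsMaxSupportVector x (supp y) ζ ∧ supp ζ = supp y := by
  set p := supp y with hp
  set r := specRad x with hr
  have hr0 : 0 ≤ r := specRad_nonneg x
  obtain ⟨C, hC⟩ := exists_norm_cutDown_pow_le hx hy
  obtain ⟨S, e, hS, he, heX⟩ := exists_abel_limit hC hr0
  have hlim : ∀ w : P.Box s 1, Tendsto (fun z : ℝ => ((z - r : ℝ) : ℂ) • act (S z) w) (𝓝[>] r)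
      (𝓝 (act e w)) := fun w => by
    simpa only [Function.comp_def, map_smul, actCLM_apply] using
      ((actCLM w).continuous.tendsto e).comp he
  have hsum : ∀ (w : P.Box s 1) (z : ℝ), r < z →
      HasSum (fun j : ℕ => ((z : ℂ) ^ (j + 1))⁻¹ • act (cutDown x p ^ j) w) (act (S z) w) :=
    fun w z hz => by
    simpa only [Function.comp_def, map_smul, actCLM_apply] using (hS z hz).mapL (actCLM w)
  have hpos : ∀ w : P.Box s 1, Pos w → Pos (act e w) := by
    intro w hw
    have hj : ∀ j : ℕ, Pos (act (P := P) (s := s) (cutDown x p ^ j) w) := by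
      rintro (_ | j)
      · rwa [pow_zero, act_one]
      · exact pos_act (fPositive_cutDown_pow hx hy j) hw
    refine isClosed_pos.mem_of_tendsto (hlim w) ?_
    filter_upwards [self_mem_nhdsWithin] with z hz
    have hz0 : 0 < z := hr0.trans_lt hz
    refine Pos.smul ?_ (sub_pos.2 hz).le
    refine isClosed_pos.mem_of_tendsto (hsum w z hz) (Eventually.of_forall fun F => ?_)
    refine Finset.sum_induction _ Pos (fun a b => Pos.add) pos_zero fun j _ => ?_
    have := (hj j).smul (inv_nonneg.2 (pow_pos hz0 (j + 1)).le)
    rwa [Complex.ofReal_inv, Complex.ofReal_pow] at this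
  -- On `y` the series is the scalar geometric series with sum `(z - r)⁻¹`, so the rescaled sums are
  -- constant.
  have hey : act e y = y := by
    refine tendsto_nhds_unique (hlim y) (tendsto_nhds_of_eventually_eq ?_)
    filter_upwards [self_mem_nhdsWithin] with z hz
    have h1 := hsum y z hz
    simp only [hp, act_cutDown_pow hx hy, smul_smul] at h1
    rw [h1.unique ((hasSum_resolvent_scalar hr0 hz).smul_const y), smul_inv_smul₀]
    exact Complex.ofReal_ne_zero.2 (sub_pos.2 hz).ne'
  obtain ⟨C₃, -, h3⟩ := exists_pos_smul_sub_supp hy.2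
  obtain ⟨C₄, -, h4⟩ := exists_pos_smul_supp_sub hy.2
  have hpp : Pos p := ⟨p, by
    rw [(isStarProjection_supp y).isSelfAdjoint.star_eq]
    exact (isStarProjection_supp y).isIdempotentElem.eq.symm⟩
  have hζ := hpos p hpp
  -- Applying the positive map `act e` to `p ≤ C₃ y` and `y ≤ C₄ p` makes `act e p` and `y`
  -- comparable.
  have hsupp : supp (act e p) = p := by
    refine supp_eq_supp hζ hy.2 (C := C₃) (D := C₄) ?_ ?_
    · have := hpos _ h3
      rwa [map_sub, map_smul, hey] at this
    · have := hpos _ h4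
      rwa [map_sub, map_smul, hey] at this
  refine ⟨act e p, mem_PFCone.2 ⟨?_, hζ⟩, ⟨S, e, hS, he, rfl⟩, hsupp⟩
  have h5 : supp y * (act e p * supp y) = act e p := by
    have e1 := mul_supp hζ.isSelfAdjoint
    have e2 := supp_mul hζ.isSelfAdjoint
    rw [hsupp] at e1 e2
    rw [← hp, e1, e2]
  -- Under `p` the box `x` acts as its cut-down, and `e x_p = r e` becomes the eigenvalue equation
  -- because `act` reverses products.
  rw [← h5, ← act_cutDown_supp hx hy, ← hp, h5, ← act_mul, heX, act_smul]

end MaxSupportVector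

/-! ### The exchange algebra of `x_ζ` and the eigenvectors of `x` -/

section Exchange

variable {x : P.Box s 2} {ζ : P.Box s 1}

theorem isSelfAdjoint_sqrtElt (ζ : P.Box s 1) : IsSelfAdjoint (sqrtElt ζ) := cfc_predicate _ ζ

theorem isSelfAdjoint_invSqrtElt (ζ : P.Box s 1) : IsSelfAdjoint (invSqrtElt ζ) := cfc_predicate _ ζ

theorem sqrtElt_mul_sqrtElt (hζ : Pos ζ) : sqrtElt ζ * sqrtElt ζ = ζ := (cfc_sqrt_facts hζ).1

theorem sqrtElt_mul_invSqrtElt (hζ : Pos ζ) : sqrtElt ζ * invSqrtElt ζ = supp ζ :=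
  (cfc_sqrt_facts hζ).2.1

theorem invSqrtElt_mul_sqrtElt (hζ : Pos ζ) : invSqrtElt ζ * sqrtElt ζ = supp ζ :=
  (cfc_sqrt_facts hζ).2.2.1

theorem supp_mul_sqrtElt (hζ : Pos ζ) : supp ζ * sqrtElt ζ = sqrtElt ζ :=
  (cfc_sqrt_facts hζ).2.2.2.1

theorem sqrtElt_mul_supp (hζ : Pos ζ) : sqrtElt ζ * supp ζ = sqrtElt ζ :=
  (cfc_sqrt_facts hζ).2.2.2.2.1

theorem supp_mul_invSqrtElt (hζ : Pos ζ) : supp ζ * invSqrtElt ζ = invSqrtElt ζ :=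
  (cfc_sqrt_facts hζ).2.2.2.2.2.1

theorem invSqrtElt_mul_supp (hζ : Pos ζ) : invSqrtElt ζ * supp ζ = invSqrtElt ζ :=
  (cfc_sqrt_facts hζ).2.2.2.2.2.2

theorem fPositive_conjElt (hx : FPositive x) (ζ : P.Box s 1) : FPositive (conjElt x ζ) :=
  (hx.juxt_mul (isSelfAdjoint_sqrtElt ζ)).mul_juxt (isSelfAdjoint_invSqrtElt ζ)

theorem act_conjElt (x : P.Box s 2) (ζ z : P.Box s 1) : act (conjElt x ζ) z =
    invSqrtElt ζ * (act x (sqrtElt ζ * (z * sqrtElt ζ)) * invSqrtElt ζ) := by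
  change act (P := P) (s := s) (dbl (sqrtElt ζ) * x * dbl (invSqrtElt ζ)) z = _
  rw [act_mul, act_mul, act_dbl, act_dbl]

theorem act_conjElt_one (hζ : ζ ∈ PFCone x) :
    act (conjElt x ζ) 1 = (specRad x : ℂ) • supp ζ := by
  rw [act_conjElt, one_mul, sqrtElt_mul_sqrtElt hζ.2, (mem_PFCone.1 hζ).1, smul_mul_assoc,
    mul_smul_comm]
  nth_rw 2 [← sqrtElt_mul_sqrtElt hζ.2]
  rw [mul_assoc, sqrtElt_mul_invSqrtElt hζ.2, sqrtElt_mul_supp hζ.2, invSqrtElt_mul_sqrtElt hζ.2]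

/-- Inserting `ζ ^ (-1/2) ζ ^ (1/2)` leaves the support projection of `ζ` on the legs of `x`, and
invariance of the support absorbs it. This intertwiner carries eigenvectors of `x_ζ` back to `x`. -/
theorem conjElt_mul_dbl (hx : FPositive x) (hζ : ζ ∈ PFCone x) :
    conjElt x ζ * dbl (sqrtElt ζ) = dbl (sqrtElt ζ) * x := by
  have h1 : dbl (invSqrtElt ζ) * dbl (sqrtElt ζ) = dbl (supp ζ) := by
    rw [dbl_mul_dbl (by rw [sqrtElt_mul_invSqrtElt hζ.2, invSqrtElt_mul_sqrtElt hζ.2]),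
      invSqrtElt_mul_sqrtElt hζ.2]
  have h2 : dbl (sqrtElt ζ) * dbl (supp ζ) = dbl (sqrtElt ζ) := by
    rw [dbl_mul_dbl (by rw [sqrtElt_mul_supp hζ.2, supp_mul_sqrtElt hζ.2]), sqrtElt_mul_supp hζ.2]
  have h3 : dbl (supp ζ) * x * dbl (supp ζ) = dbl (supp ζ) * x := (dbl_supp_mul hx hζ).symm
  change dbl (sqrtElt ζ) * x * dbl (invSqrtElt ζ) * dbl (sqrtElt ζ) = dbl (sqrtElt ζ) * x
  rw [mul_assoc, h1]
  nth_rw 1 [← h2]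
  rw [mul_assoc, mul_assoc, ← mul_assoc _ x, h3, ← mul_assoc, h2]

/-- The exchange relation `M (c ⊗ 1) = (c ⊗ 1) M`, with `M = x_ζ`, is evaluated at `1`. -/
theorem act_conjElt_of_mem_exchange (hζ : ζ ∈ PFCone x) {c : P.Box s 1}
    (hc : c ∈ exchange (conjElt x ζ)) :
    act (conjElt x ζ) c = (specRad x : ℂ) • (supp ζ * c) := by
  have h := congrArg (fun w : P.Box s 2 => act w 1) hc.2
  simp only [act_mul, act_juxt_one, one_mul, act_conjElt_one hζ] at h
  rw [← h, smul_mul_assoc]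

/-- Positive elements of the exchange algebra give eigenvectors. -/
theorem sqrtElt_conj_mem_PFCone (hx : FPositive x) (hζ : ζ ∈ PFCone x) {c : P.Box s 1}
    (hc : c ∈ exchangePos (conjElt x ζ)) : sqrtElt ζ * c * sqrtElt ζ ∈ PFCone x := by
  refine mem_PFCone.2 ⟨?_, hc.2.conj_self (isSelfAdjoint_sqrtElt ζ)⟩
  rw [mul_assoc, ← act_dbl, ← act_mul, ← conjElt_mul_dbl hx hζ, act_mul,
    act_conjElt_of_mem_exchange hζ hc.1, act_dbl, act_dbl, smul_mul_assoc, mul_smul_comm, mul_assoc,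
    ← mul_assoc _ (supp ζ), sqrtElt_mul_supp hζ.2]

/-- A positive element of the form `x̂ g - r g` vanishes if it is supported in `p`. -/
theorem eq_zero_of_isRightPF {p g : P.Box s 1} {y₁ q₁ : P.Box (!s) 1} (h1 : IsRightPF x y₁)
    (hq : IsRangeProj y₁ q₁) (hm : MeetZero p (1 - P.bar (s := !s) (t := s) (shade_one s) q₁))
    (hY : Pos (act x g - (specRad x : ℂ) • g))
    (hpY : IsStarProjection p)
    (hp : p * (act x g - (specRad x : ℂ) • g) = act x g - (specRad x : ℂ) • g) :
    act x g = (specRad x : ℂ) • g := by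
  set Y := act x g - (specRad x : ℂ) • g with hYdef
  set B := P.bar (s := !s) (t := s) (shade_one s) y₁ with hB
  have hBpos : Pos B := h1.2.1.bar _
  -- Under the trace the left convolution by `x̂` moves to the right convolution on `y₁`, where it
  -- is multiplication by `r`.
  have htr : P.tr s 1 (Y * B) = 0 := by
    rw [hYdef, sub_mul, map_sub, hB, tr_act_mul_bar, h1.1, bar_smul, smul_mul_assoc, mul_smul_comm,
      sub_self]
  have hBY : B * Y = 0 := by
    obtain ⟨a, ha⟩ := hY
    obtain ⟨b, hb⟩ := hBpos
    -- With `Y = a a⋆` and `B = b b⋆`, `tr(Y B)` is the trace of `(b⋆ a)(b⋆ a)⋆`, so faithfulness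
    -- applies.
    have h2 : star b * a = 0 := by
      by_contra h0
      have h3 := tr_mul_star_pos h0
      have h4 : star b * a * star (star b * a) = star b * (Y * b) := by
        rw [ha, star_mul, star_star]; simp only [mul_assoc]
      rw [h4, tr_mul_comm, mul_assoc, ← hb, htr, Complex.zero_re] at h3
      exact h3.false
    rw [hb, ha, mul_assoc, ← mul_assoc (star b), h2, zero_mul, mul_zero]
  have hYs := hY.isSelfAdjoint
  have hqY : P.bar (s := !s) (t := s) (shade_one s) q₁ * supp Y = 0 := by
    rw [hq.eq_supp h1.2.1.isSelfAdjoint, ← mul_pinv h1.2.1.isSelfAdjoint, bar_mul, ← mul_pinv hYs,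
      mul_assoc, ← mul_assoc _ Y, hBY, zero_mul, mul_zero]
  have h0 : supp Y = 0 := by
    -- The support of `Y` lies under `p` and is orthogonal to the rotated support of `y₁`.
    refine hm _ (isStarProjection_supp Y) ((isRangeProj_supp hYs).2.2 _ hpY hp) ?_
    rw [sub_mul, one_mul, hqY, sub_zero]
  have : Y = 0 := by rw [← supp_mul hYs, h0, zero_mul]
  exact sub_eq_zero.1 this

/-- The element whose Fourier transform is `(1 ⊗ c - c̄ ⊗ 1) x̂ (1 ⊗ c - c̄ ⊗ 1)`. -/
def exchangeDefect (x : P.Box s 2) (c : P.Box s 1) : P.Box s 2 :=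
  x * dbl c - P.juxt c 1 * (x * P.juxt 1 (P.bar (shade_not_one s) c)) -
    P.juxt 1 (P.bar (shade_not_one s) c) * (x * P.juxt c 1) + dbl c * x

theorem fourier_exchangeDefect (x : P.Box s 2) (c : P.Box s 1) :
    P.fourier (exchangeDefect x c) = (rt c - lt c) * P.fourier x * (rt c - lt c) := by
  have h : P.fourier (exchangeDefect x c) = P.fourier (x * dbl c) -
      P.fourier (P.juxt c 1 * (x * P.juxt 1 (P.bar (shade_not_one s) c))) -
      P.fourier (P.juxt 1 (P.bar (shade_not_one s) c) * (x * P.juxt c 1)) +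
      P.fourier (dbl c * x) := by
    change fourierL P s _ = fourierL P s _ - fourierL P s _ - fourierL P s _ + fourierL P s _
    rw [exchangeDefect, map_add, map_sub, map_sub]
  rw [h, fourier_juxt_one_mul, fourier_mul_one_juxt, fourier_one_juxt_mul, fourier_mul_juxt_one,
    dbl,
    fourier_mul_juxt, fourier_juxt_mul]
  noncomm_ring

theorem isSelfAdjoint_rt_sub_lt {c : P.Box s 1} (hc : IsSelfAdjoint c) :
    IsSelfAdjoint (rt c - lt c) := by
  rw [IsSelfAdjoint, star_sub, star_rt, star_lt, hc.star_eq]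

theorem fPositive_exchangeDefect {c : P.Box s 1} (hx : FPositive x) (hc : IsSelfAdjoint c) :
    FPositive (exchangeDefect x c) := by
  rw [FPositive, fourier_exchangeDefect]
  exact Pos.conj_self hx (isSelfAdjoint_rt_sub_lt hc)

/-- The exchange relations hold when the exchange defect is annihilated by the trace vector. -/
theorem mem_exchange_of_act_exchangeDefect {c : P.Box s 1} (hx : FPositive x)
    (hc : IsSelfAdjoint c) (h : act (exchangeDefect x c) 1 = 0) : c ∈ exchange x := by
  have hN := isSelfAdjoint_rt_sub_lt hc
  have h1 : P.fourier x * (rt c - lt c) = 0 := by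
    refine Pos.mul_eq_zero hx ?_
    rw [hN.star_eq, ← fourier_exchangeDefect, (fPositive_exchangeDefect hx hc).eq_zero h]
    exact map_zero (fourierL P s)
  have h2 : (rt c - lt c) * P.fourier x = 0 := by
    have := congrArg star h1
    rwa [star_mul, hN.star_eq, (Pos.isSelfAdjoint hx).star_eq, star_zero] at this
  rw [mul_sub, sub_eq_zero] at h1
  rw [sub_mul, sub_eq_zero] at h2
  constructor
  · refine fourierL_injective s ((fourier_mul_one_juxt _ _).trans (h2.trans ?_))
    exact (fourier_one_juxt_mul _ _).symm
  · refine fourierL_injective s ((fourier_mul_juxt_one _ _).trans (h1.trans ?_))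
    exact (fourier_juxt_one_mul _ _).symm

/-- Each of the first three terms of the defect contributes `± r c²` at `1`, with one plus and two
minus signs; the last contributes `act x (c²)`. -/
theorem act_exchangeDefect_one {c : P.Box s 1} {r : ℂ} {p : P.Box s 1}
    (h1 : act x 1 = r • p) (hpc : p * c = c) (hc : act x c = r • c) :
    act (exchangeDefect x c) 1 = act x (c * c) - r • (c * c) := by
  rw [exchangeDefect, act_add, act_sub, act_sub, act_mul, act_dbl, h1, act_mul, act_mul,
    act_one_juxt, act_juxt_one, one_mul, hc, act_mul, act_mul, act_juxt_one, act_one_juxt, mul_one,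
    hc, act_mul, act_dbl, one_mul, smul_mul_assoc, hpc, mul_smul_comm, smul_mul_assoc]
  abel

/-- Eigenvectors come from positive elements of the exchange algebra. -/
theorem exists_mem_exchangePos (hx : FPositive x) (hζ : ζ ∈ PFCone x) (hmax : IsPMax x (supp ζ))
    {y₁ q₁ : P.Box (!s) 1} (h1 : IsRightPF x y₁) (hq : IsRangeProj y₁ q₁)
    (hm : MeetZero (supp ζ) (1 - P.bar (s := !s) (t := s) (shade_one s) q₁))
    {y : P.Box s 1} (hy : y ∈ PFCone x) :
    ∃ c ∈ exchangePos (conjElt x ζ), sqrtElt ζ * c * sqrtElt ζ = y := by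
  have hζp := hζ.2
  have hys := hy.2.isSelfAdjoint
  -- Maximality of the support of `ζ` places every positive eigenvector under it, so conjugation by
  -- `ζ ^ (-1/2)` loses nothing.
  have hpy : supp ζ * y = y := by
    have := hmax.2 _ ⟨y, hy, isRangeProj_supp hys⟩
    rw [← supp_mul hys, ← mul_assoc, this]
  have hyp : y * supp ζ = y := by
    have := congrArg star hpy
    rwa [star_mul, hys.star_eq, (isStarProjection_supp ζ).isSelfAdjoint.star_eq] at this
  set c := invSqrtElt ζ * y * invSqrtElt ζ with hcdef
  have hc : Pos c := hy.2.conj_self (isSelfAdjoint_invSqrtElt ζ)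
  have hcs := hc.isSelfAdjoint
  have hpc : supp ζ * c = c := by
    rw [hcdef, ← mul_assoc, ← mul_assoc, supp_mul_invSqrtElt hζp]
  have hcp : c * supp ζ = c := by rw [hcdef, mul_assoc, invSqrtElt_mul_supp hζp]
  have hhch : sqrtElt ζ * (c * sqrtElt ζ) = y := by
    rw [hcdef, mul_assoc, invSqrtElt_mul_sqrtElt hζp, mul_assoc, hyp, ← mul_assoc,
      sqrtElt_mul_invSqrtElt hζp, hpy]
  refine ⟨c, ⟨?_, hc⟩, by rw [mul_assoc, hhch]⟩
  have hMc : act (conjElt x ζ) c = (specRad x : ℂ) • c := by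
    rw [act_conjElt, hhch, (mem_PFCone.1 hy).1, smul_mul_assoc, mul_smul_comm, hcdef, mul_assoc]
  have hM := fPositive_conjElt hx ζ
  have hD := act_exchangeDefect_one (act_conjElt_one hζ) hpc hMc
  refine mem_exchange_of_act_exchangeDefect hM hcs ?_
  have hDpos : Pos (act (exchangeDefect (conjElt x ζ) c) 1) :=
    pos_act (fPositive_exchangeDefect hM hcs) ⟨1, by rw [star_one, mul_one]⟩
  rw [hD] at hDpos ⊢
  -- The defect inequality for `x_ζ` at `c²`, conjugated by `ζ ^ (1/2)`, becomes `act x g ≥ r g`,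
  -- the form in which the right eigenvector can be used.
  set g := sqrtElt ζ * (c * c * sqrtElt ζ) with hg
  have hgp : supp ζ * (g * supp ζ) = g := by
    rw [hg, mul_assoc, mul_assoc (c * c), sqrtElt_mul_supp hζp, ← mul_assoc,
      supp_mul_sqrtElt hζp]
  have hpg : supp ζ * (act x g * supp ζ) = act x g := by
    have := supp_mul_act hx hζ g
    rwa [hgp] at this
  have hYeq : sqrtElt ζ * (act (conjElt x ζ) (c * c) - (specRad x : ℂ) • (c * c)) * sqrtElt ζ =
      act x g - (specRad x : ℂ) • g := by
    rw [act_conjElt, ← hg, mul_sub, sub_mul]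
    congr 1
    · rw [← mul_assoc, sqrtElt_mul_invSqrtElt hζp, mul_assoc, mul_assoc,
        invSqrtElt_mul_sqrtElt hζp, hpg]
    · rw [mul_smul_comm, smul_mul_assoc, mul_assoc]
  have hY := hDpos.conj_self (isSelfAdjoint_sqrtElt ζ)
  have hpY : supp ζ * (act x g - (specRad x : ℂ) • g) = act x g - (specRad x : ℂ) • g := by
    rw [← hYeq, ← mul_assoc, ← mul_assoc, supp_mul_sqrtElt hζp]
  rw [hYeq] at hY
  have hfin := eq_zero_of_isRightPF h1 hq hm hY (isStarProjection_supp ζ) hpY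
  rw [act_conjElt, ← hg, hfin, smul_mul_assoc, mul_smul_comm, hg, mul_assoc, mul_assoc (c * c),
    sqrtElt_mul_invSqrtElt hζp, mul_assoc, hcp, ← mul_assoc, invSqrtElt_mul_sqrtElt hζp,
    ← mul_assoc, hpc, sub_self]

end Exchange

end CStarPlanarAlgebra

end

open CStarPlanarAlgebra in
theorem theorem5p10 (P : CStarPlanarAlgebra.{u}) (s : Bool) (x : P.Box s 2) (hx : FPositive x) :
    ∃ p ζ : P.Box s 1, IsPMax x p ∧ IsMaxSupportVector x p ζ ∧
      ((∃ y₁ q₁ : P.Box (!s) 1, IsRightPF x y₁ ∧ IsRangeProj y₁ q₁ ∧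
          MeetZero p (1 - P.bar (s := !s) (t := s) (shade_one s) q₁)) →
        PFCone x = (fun c => sqrtElt ζ * c * sqrtElt ζ) '' exchangePos (conjElt x ζ)) := by
  obtain ⟨y, hy, hmax⟩ := exists_isPMax x
  obtain ⟨ζ, hζ, hvec, hsupp⟩ := exists_maxSupportVector hx hy
  refine ⟨supp y, ζ, hmax, hvec, ?_⟩
  rintro ⟨y₁, q₁, h1, hq, hm⟩
  rw [← hsupp] at hmax hm
  refine Set.Subset.antisymm (fun y' hy' => exists_mem_exchangePos hx hζ hmax h1 hq hm hy') ?_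
  rintro _ ⟨c, hc, rfl⟩
  exact sqrtElt_conj_mem_PFCone hx hζ hc
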